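/- Let $d\ge 2$. For every $\rho>0$ let $\eta_\rho=\sum_{i}\delta_{Y^{(i,\rho)}}$ be a homogeneous Poisson point process on $\mathbb{R}^{d-1}$ with intensity $\rho$, let $W^{(i,\rho)}$, $i\in\mathbb{N}$, be independent standard Brownian motions in $\mathbb{R}^{d-1}$ started at the origin and independent of the points $Y^{(i,\rho)}$, and set $X^{(i,\rho)}_t=Y^{(i,\rho)}+W^{(i,\rho)}_t$ with space-time trajectory $X^{(i,\rho)}=\{(X^{(i,\rho)}_t,t):t\ge 0\}\subset\mathbb{R}^d$. For $K\subset\mathbb{R}^d$ let $$\mathcal{X}_\rho(K)=\bigcup_{i\,:\,Y^{(i,\rho)}\in[0,1]^{d-1}}\bigl(X^{(i,\rho)}\oplus K\bigr),\qquad R_\rho(K)=\inf\{r\ge 0:\ [0,1]^d\subset\mathcal{X}_\rho(rK)\},$$ where $\oplus$ is the Minkowski sum and $\inf\emptyset=\infty$. Let $B'_{d-1}(o,1)=B_{d-1}(o,1)\times\{0\}$ be the flat $(d-1)$-dimensional unit ball in $\mathbb{R}^d$. Then there exist constants $0<c_1\le c_2<\infty$, depending only on $d$, such that $$\mathbb{P}\left(c_1\le\frac{R_\rho(B'_{d-1}(o,1))}{(\log\rho/\rho)^{1/(d-1)}}\le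 c_2\right)\to 1\qquad\text{as }\rho\to\infty.$$ -/

import Mathlib

open MeasureTheory ProbabilityTheory Filter Topology Set
open scoped NNReal ENNReal Pointwise

namespace BrownianCylinders

/-! ### Poisson point processes and multidimensional Brownian motion -/

section Processes

variable {Ω : Type*} [MeasurableSpace Ω]

/-- The random point measure `∑ i, δ_{Y i}` of an enumerated family of random points
(points are counted with multiplicity). -/
noncomputable def pointMeasure {E : Type*} [MeasurableSpace E] (Y : ℕ → Ω → E) (ω : Ω) :
    Measure E :=
  Measure.sum fun i => Measure.dirac (Y i ω)

/-- The random points `Y 0, Y 1, …` enumerate a Poisson point process with intensity measure `μ`: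
the number of points in a measurable set `B` of finite intensity is Poisson distributed with
mean `μ B`, and the numbers of points in disjoint measurable sets are independent. -/
structure IsPoissonProcess {E : Type*} [MeasurableSpace E] (Y : ℕ → Ω → E) (μ : Measure E)
    (P : Measure Ω) : Prop where
  measurable : ∀ i, Measurable (Y i)
  hasLaw : ∀ B : Set E, MeasurableSet B → μ B < ∞ →
    HasLaw (fun ω => pointMeasure Y ω B)
      ((poissonMeasure (μ B).toNNReal).map (fun n : ℕ => (n : ℝ≥0∞))) P
  indep : ∀ (n : ℕ) (B : Fin n → Set E), (∀ k, MeasurableSet (B k)) →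
    (Pairwise fun k l => Disjoint (B k) (B l)) →
    iIndepFun (fun k ω => pointMeasure Y ω (B k)) P

/-- Standard Brownian motion in `ℝ^m`, started at the origin: the coordinate processes are
independent standard real Brownian motions. -/
structure IsBrownian {m : ℕ} (W : ℝ≥0 → Ω → EuclideanSpace ℝ (Fin m)) (P : Measure Ω) :
    Prop where
  measurable : ∀ t, Measurable (W t)
  isBrownianReal : ∀ j, IsBrownianReal (fun t ω => W t ω j) P
  indep : iIndepFun (fun j ω t => W t ω j) P

/-- The Brownian model of intensity `ρ` in `ℝ^m`: the starting points `Y i` enumerate a homogeneous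
Poisson process of intensity `ρ`, the `W i` are independent standard Brownian motions, and the
Brownian motions are independent of the starting points. -/
structure IsBrownianModel {m : ℕ} (ρ : ℝ) (Y : ℕ → Ω → EuclideanSpace ℝ (Fin m))
    (W : ℕ → ℝ≥0 → Ω → EuclideanSpace ℝ (Fin m)) (P : Measure Ω) : Prop where
  poisson : IsPoissonProcess Y (ENNReal.ofReal ρ • volume) P
  brownian : ∀ i, IsBrownian (W i) P
  indep_motions : iIndepFun (fun i ω t => W i t ω) P
  indep_starts : IndepFun (fun ω i => Y i ω) (fun ω i t => W i t ω) P

end Processes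

/-! ### Generalized cylinder sets; `ℝ^d` is written as `ℝ^(d-1) × ℝ`, with `m = d - 1` -/

section Geometry

variable {m : ℕ}

/-- The cube `[0,1]^m`. -/
def base (m : ℕ) : Set (EuclideanSpace ℝ (Fin m)) := {y | ∀ j, y j ∈ Icc (0 : ℝ) 1}

/-- The cube `[0,1]^m × [0,1]`. -/
def unitCube (m : ℕ) : Set (EuclideanSpace ℝ (Fin m) × ℝ) := base m ×ˢ Icc (0 : ℝ) 1

/-- The flat ball `B_m(o,r) × {0}`. -/
def flatBall (m : ℕ) (r : ℝ) : Set (EuclideanSpace ℝ (Fin m) × ℝ) :=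
  Metric.closedBall 0 r ×ˢ {0}

/-- The space-time trajectory `{(x t, t) : t ≥ 0}`. -/
def trajectory (x : ℝ≥0 → EuclideanSpace ℝ (Fin m)) : Set (EuclideanSpace ℝ (Fin m) × ℝ) :=
  range fun t : ℝ≥0 => (x t, (t : ℝ))

/-- The generalized cylinder set: the union of the Minkowski sums with `K` of the trajectories
`x i` whose starting point `y i` lies in `[0,1]^m`. -/
def cylinderSet (y : ℕ → EuclideanSpace ℝ (Fin m)) (x : ℕ → ℝ≥0 → EuclideanSpace ℝ (Fin m))
    (K : Set (EuclideanSpace ℝ (Fin m) × ℝ)) : Set (EuclideanSpace ℝ (Fin m) × ℝ) :=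
  ⋃ i ∈ {i | y i ∈ base m}, trajectory (x i) + K

/-- The coverage radius: the infimum of all `r ≥ 0` for which the generalized cylinder set formed
with `r • K` contains the unit cube; it is `∞` if there is no such `r`. -/
noncomputable def coverageRadius (y : ℕ → EuclideanSpace ℝ (Fin m))
    (x : ℕ → ℝ≥0 → EuclideanSpace ℝ (Fin m)) (K : Set (EuclideanSpace ℝ (Fin m) × ℝ)) : ℝ≥0∞ :=
  ⨅ (r : ℝ≥0) (_ : unitCube m ⊆ cylinderSet y x ((r : ℝ) • K)), (r : ℝ≥0∞)

end Geometry

/-- The coverage radius `R_ρ(K)` as a random variable, for the processes `X i t = Y i + W i t`. -/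
noncomputable def brownianCoverageRadius {Ω : Type*} {m : ℕ}
    (Y : ℕ → Ω → EuclideanSpace ℝ (Fin m)) (W : ℕ → ℝ≥0 → Ω → EuclideanSpace ℝ (Fin m))
    (K : Set (EuclideanSpace ℝ (Fin m) × ℝ)) (ω : Ω) : ℝ≥0∞ :=
  coverageRadius (fun i => Y i ω) (fun i t => Y i ω + W i t ω) K

end BrownianCylinders

/-! Write `m = d - 1`. Because the ball is flat, the section of the cylinder set at time `t` is a
union of `m`-balls about the positions at time `t` of the particles started in the cube. Coverage
becomes an occupancy problem for a grid of `n ^ m` cells, with threshold `n ^ m` of order `ρ / log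
ρ`.

Lower bound: time `0` alone suffices. A radius below `1 / (2 * n)` forces a starting point into
every cell (`exists_mem_cell_of_subset_cylinderSet`). The cell counts are independent Poisson
variables, and for `n ^ m` about `2 * ρ / log ρ` the expected number of empty cells diverges, so
full occupancy has vanishing probability (`measure_coverageRadius_lt_le`).

Upper bound: for `n ^ m` a small multiple of `ρ / log ρ`, all cells are hit at all times `l / T`,
and between these times the paths hardly move (`coverageRadius_le`). The first claim rests on a void
bound for the marked Poisson process (`measure_forall_notMem_le`) and on the fact that a fixed
proportion of the volume of a cell counts as hitting intensity from the cube
(`le_lintegral_heatMeasure_hitSet`). The second is a dyadic chaining estimate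
(`measure_roughFunctions_le`, `abs_sub_gridFloor_le`), summed over the particles, of which `ρ` are
expected in the cube. `T` is polynomial in `ρ`, so union bounds suffice. -/

namespace BrownianCylinders

/-! ### Exponentials on `[0, ∞]` and Laplace transforms of Poisson variables. -/

/-- The function `x ↦ exp (-x)` on `[0, ∞]`, with value `0` at `∞`. -/
noncomputable def negExp (x : ℝ≥0∞) : ℝ≥0∞ := EReal.exp (-(x : EReal))

theorem negExp_zero : negExp 0 = 1 := by simp [negExp]

theorem negExp_add (x y : ℝ≥0∞) : negExp (x + y) = negExp x * negExp y := by
  rw [negExp, EReal.coe_ennreal_add, EReal.neg_add, sub_eq_add_neg, EReal.exp_add, negExp, negExp]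
  · left; exact EReal.coe_ennreal_ne_bot x
  · right; exact EReal.coe_ennreal_ne_bot y

theorem negExp_sum {ι : Type*} (s : Finset ι) (f : ι → ℝ≥0∞) :
    negExp (∑ i ∈ s, f i) = ∏ i ∈ s, negExp (f i) := by
  classical
  induction s using Finset.induction_on with
  | empty => simp [negExp_zero]
  | insert a s ha ih => rw [Finset.sum_insert ha, Finset.prod_insert ha, negExp_add, ih]

theorem negExp_antitone : Antitone negExp := fun x y h => by
  unfold negExp
  rw [EReal.exp_le_exp_iff, EReal.neg_le_neg_iff]
  exact_mod_cast h

theorem continuous_negExp : Continuous negExp := by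
  unfold negExp
  have h1 : Continuous EReal.exp := ENNReal.continuous_exp
  exact h1.comp (continuous_neg.comp continuous_coe_ennreal_ereal)

theorem negExp_le_one (x : ℝ≥0∞) : negExp x ≤ 1 :=
  (negExp_antitone (zero_le)).trans_eq negExp_zero

theorem negExp_ofReal {x : ℝ} (hx : 0 ≤ x) :
    negExp (ENNReal.ofReal x) = ENNReal.ofReal (Real.exp (-x)) := by
  rw [negExp, EReal.coe_ennreal_ofReal, max_eq_left hx, ← EReal.coe_neg, EReal.exp_coe]

theorem one_sub_le_negExp (x : ℝ≥0∞) : 1 - x ≤ negExp x := by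
  rcases le_or_gt 1 x with h | h
  · simp [tsub_eq_zero_of_le h]
  · have hx : x ≠ ∞ := (h.trans ENNReal.one_lt_top).ne
    rw [← ENNReal.ofReal_toReal hx, negExp_ofReal ENNReal.toReal_nonneg, ← ENNReal.ofReal_one,
      ← ENNReal.ofReal_sub _ ENNReal.toReal_nonneg]
    exact ENNReal.ofReal_le_ofReal (by linarith [Real.add_one_le_exp (-x.toReal)])

theorem lintegral_poissonMeasure (r : ℝ≥0) (f : ℕ → ℝ≥0∞) :
    ∫⁻ n, f n ∂poissonMeasure r
      = ∑' n, ENNReal.ofReal (Real.exp (-r) * r ^ n / n.factorial) * f n := by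
  simp [poissonMeasure, lintegral_sum_measure, lintegral_smul_measure]

theorem lintegral_natCast_poissonMeasure (r : ℝ≥0) :
    ∫⁻ n : ℕ, (n : ℝ≥0∞) ∂poissonMeasure r = r := by
  rw [lintegral_poissonMeasure, tsum_eq_zero_add' ENNReal.summable]
  have h : ∀ n : ℕ, ENNReal.ofReal (Real.exp (-r) * r ^ (n + 1) / (n + 1).factorial) *
      ((n + 1 : ℕ) : ℝ≥0∞) = r * ENNReal.ofReal (Real.exp (-r) * r ^ n / n.factorial) := by
    intro n
    rw [← ENNReal.ofReal_natCast, ← ENNReal.ofReal_mul (by positivity),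
      ← ENNReal.ofReal_coe_nnreal, ← ENNReal.ofReal_mul (by positivity)]
    congr 1
    rw [Nat.factorial_succ]
    push_cast
    field_simp
    ring
  simp only [h, ENNReal.tsum_mul_left]
  rw [← ENNReal.ofReal_tsum_of_nonneg (fun n => by positivity)
    (hasSum_one_poissonMeasure r).summable, (hasSum_one_poissonMeasure r).tsum_eq]
  simp

theorem lintegral_negExp_poissonMeasure (r : ℝ≥0) {a : ℝ} (ha : 0 ≤ a) :
    ∫⁻ n : ℕ, negExp (ENNReal.ofReal a * n) ∂poissonMeasure r
      = ENNReal.ofReal (Real.exp (-(r * (1 - Real.exp (-a))))) := by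
  rw [lintegral_poissonMeasure]
  have h : ∀ n : ℕ, ENNReal.ofReal (Real.exp (-r) * r ^ n / n.factorial) *
      negExp (ENNReal.ofReal a * n) =
      ENNReal.ofReal (Real.exp (-r) * ((r * Real.exp (-a)) ^ n / n.factorial)) := by
    intro n
    rw [← ENNReal.ofReal_natCast, ← ENNReal.ofReal_mul ha, negExp_ofReal (by positivity),
      ← ENNReal.ofReal_mul (by positivity)]
    congr 1
    rw [mul_pow, ← Real.exp_nat_mul]
    ring_nf
  simp only [h]
  have hs := (NormedSpace.expSeries_div_hasSum_exp (r * Real.exp (-a) : ℝ)).mul_left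
    (Real.exp (-r))
  rw [← ENNReal.ofReal_tsum_of_nonneg (fun n => by positivity) hs.summable, hs.tsum_eq,
    ← Real.exp_eq_exp_ℝ, ← Real.exp_add]
  congr 2
  ring

/-- Turns the Poisson exponent `1 - exp (-a)` into something linear in `a`. The price is the factor
`1 / 2` in all later void bounds, which only affects constants. -/
theorem exp_neg_le_one_sub_half {a : ℝ} (h0 : 0 ≤ a) (h1 : a ≤ 1) : Real.exp (-a) ≤ 1 - a / 2 := by
  rw [Real.exp_neg]
  have h := Real.add_one_le_exp a
  calc (Real.exp a)⁻¹ ≤ (a + 1)⁻¹ := by gcongr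
    _ ≤ 1 - a / 2 := by
      rw [inv_le_iff_one_le_mul₀ (by positivity)]
      nlinarith

/-! ### Laplace functionals and void bounds for Poisson processes. -/

section Poisson

variable {Ω E : Type*} [MeasurableSpace Ω] [MeasurableSpace E] {P : Measure Ω}
  {Y : ℕ → Ω → E} {μ : Measure E}

omit [MeasurableSpace Ω] in
theorem pointMeasure_apply (Y : ℕ → Ω → E) (ω : Ω) {B : Set E} (hB : MeasurableSet B) :
    pointMeasure Y ω B = ∑' i, B.indicator 1 (Y i ω) := by
  simp [pointMeasure, Measure.sum_apply _ hB, Measure.dirac_apply' _ hB]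

omit [MeasurableSpace Ω] in
theorem lintegral_pointMeasure (Y : ℕ → Ω → E) (ω : Ω) {f : E → ℝ≥0∞} (hf : Measurable f) :
    ∫⁻ x, f x ∂pointMeasure Y ω = ∑' i, f (Y i ω) := by
  simp [pointMeasure, lintegral_sum_measure, lintegral_dirac' _ hf]

namespace IsPoissonProcess

theorem measurable_pointMeasure (h : IsPoissonProcess Y μ P) {B : Set E} (hB : MeasurableSet B) :
    Measurable fun ω => pointMeasure Y ω B := by
  simp only [pointMeasure_apply Y _ hB]
  exact Measurable.tsum fun i => (measurable_one.indicator hB).comp (h.measurable i)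

theorem lintegral_comp_pointMeasure (h : IsPoissonProcess Y μ P) {B : Set E}
    (hB : MeasurableSet B) (hμ : μ B < ∞) {f : ℝ≥0∞ → ℝ≥0∞} (hf : Measurable f) :
    ∫⁻ ω, f (pointMeasure Y ω B) ∂P = ∫⁻ n : ℕ, f n ∂poissonMeasure (μ B).toNNReal := by
  rw [(h.hasLaw B hB hμ).lintegral_comp hf.aemeasurable, lintegral_map hf .of_discrete]

theorem lintegral_pointMeasure_apply (h : IsPoissonProcess Y μ P) {B : Set E}
    (hB : MeasurableSet B) (hμ : μ B < ∞) : ∫⁻ ω, pointMeasure Y ω B ∂P = μ B := by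
  rw [h.lintegral_comp_pointMeasure hB hμ (f := fun x => x) measurable_id,
    lintegral_natCast_poissonMeasure]
  exact ENNReal.coe_toNNReal hμ.ne

theorem measure_pointMeasure_ne_zero (h : IsPoissonProcess Y μ P) {B : Set E}
    (hB : MeasurableSet B) (hμ : μ B < ∞) :
    P {ω | pointMeasure Y ω B ≠ 0} = ENNReal.ofReal (1 - Real.exp (-(μ B).toReal)) := by
  have := (h.hasLaw B hB hμ).isProbabilityMeasure
  have h0 : P {ω | pointMeasure Y ω B = 0} = ENNReal.ofReal (Real.exp (-(μ B).toReal)) := by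
    rw [(h.hasLaw B hB hμ).measure_eq (p := fun x => x = 0) (by simp),
      Measure.map_apply .of_discrete (by simp)]
    have : ((fun n : ℕ => (n : ℝ≥0∞)) ⁻¹' {x | x = 0}) = {0} := by ext; simp
    rw [this, poissonMeasure_singleton]
    simp only [pow_zero, mul_one, Nat.factorial_zero, Nat.cast_one, div_one]
    rfl
  have hm : MeasurableSet {ω | pointMeasure Y ω B = 0} :=
    h.measurable_pointMeasure hB (measurableSet_singleton 0)
  have : {ω | pointMeasure Y ω B ≠ 0} = {ω | pointMeasure Y ω B = 0}ᶜ := rfl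
  rw [this, prob_compl_eq_one_sub hm, h0, ENNReal.ofReal_sub _ (Real.exp_nonneg _),
    ENNReal.ofReal_one]

/-- Finiteness of `μ B` is required only for `a ≠ 0`, since the zero level set of a simple function
usually has infinite intensity. -/
theorem lintegral_negExp_mul_le (h : IsPoissonProcess Y μ P) [IsProbabilityMeasure P] {B : Set E}
    (hB : MeasurableSet B) {a : ℝ≥0∞} (ha : a ≤ 1) (hμ : a ≠ 0 → μ B < ∞) :
    ∫⁻ ω, negExp (a * pointMeasure Y ω B) ∂P ≤ negExp (a * μ B / 2) := by
  rcases eq_or_ne a 0 with rfl | h0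
  · simp [negExp_zero]
  specialize hμ h0
  have ha' : a ≠ ∞ := (ha.trans_lt ENNReal.one_lt_top).ne
  rw [h.lintegral_comp_pointMeasure hB hμ (f := fun x => negExp (a * x))
    (continuous_negExp.measurable.comp (measurable_const_mul a))]
  conv_lhs => rw [← ENNReal.ofReal_toReal ha']
  rw [lintegral_negExp_poissonMeasure _ ENNReal.toReal_nonneg]
  have : a * μ B / 2 = ENNReal.ofReal (a.toReal * (μ B).toReal / 2) := by
    rw [ENNReal.ofReal_div_of_pos (by norm_num), ENNReal.ofReal_mul ENNReal.toReal_nonneg,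
      ENNReal.ofReal_toReal ha', ENNReal.ofReal_toReal hμ.ne]
    simp
  rw [this, negExp_ofReal (by positivity)]
  gcongr
  have h1 := exp_neg_le_one_sub_half (a := a.toReal) ENNReal.toReal_nonneg
    (ENNReal.toReal_le_of_le_ofReal zero_le_one (by simpa using ha))
  have h2 : ((μ B).toNNReal : ℝ) = (μ B).toReal := rfl
  rw [h2]
  nlinarith [ENNReal.toReal_nonneg (a := μ B)]

/-- The level sets of `g` are disjoint, so their counts are independent and the Laplace functional
factors into one-set transforms. -/
theorem lintegral_negExp_simpleFunc_le (h : IsPoissonProcess Y μ P) [IsProbabilityMeasure P]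
    (g : SimpleFunc E ℝ≥0∞) (hg : ∀ x, g x ≤ 1) (hμ : ∫⁻ x, g x ∂μ ≠ ∞) :
    ∫⁻ ω, negExp (∫⁻ x, g x ∂pointMeasure Y ω) ∂P ≤ negExp ((∫⁻ x, g x ∂μ) / 2) := by
  have hfin : ∀ a ≠ 0, μ (g ⁻¹' {a}) < ∞ := by
    intro a ha
    rcases eq_or_ne a ∞ with rfl | ha'
    · have : g ⁻¹' {∞} = ∅ := by
        ext x
        simpa using ((hg x).trans_lt ENNReal.one_lt_top).ne
      simp [this]
    · refine (measure_mono ?_).trans_lt ((meas_ge_le_lintegral_div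
        g.measurable.aemeasurable ha ha').trans_lt (ENNReal.div_lt_top hμ ha))
      intro x hx
      exact (show g x = a from hx).ge
  let e := g.range.equivFin.symm
  have hB : ∀ k, MeasurableSet (g ⁻¹' {((e k : g.range) : ℝ≥0∞)}) := fun k =>
    g.measurableSet_fiber _
  have hdisj : Pairwise fun k l => Disjoint (g ⁻¹' {((e k : g.range) : ℝ≥0∞)})
      (g ⁻¹' {((e l : g.range) : ℝ≥0∞)}) := by
    intro k l hkl
    refine Disjoint.preimage _ ?_
    rw [Set.disjoint_singleton]
    exact fun he => hkl (e.injective (Subtype.ext he))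
  have hsum : ∀ ν : Measure E, ∫⁻ x, g x ∂ν =
      ∑ k, ((e k : g.range) : ℝ≥0∞) * ν (g ⁻¹' {((e k : g.range) : ℝ≥0∞)}) := by
    intro ν
    rw [SimpleFunc.lintegral_eq_lintegral, SimpleFunc.lintegral,
      ← Finset.sum_coe_sort g.range (fun x => x * ν (g ⁻¹' {x}))]
    exact (Equiv.sum_comp e (fun x : g.range => (x : ℝ≥0∞) * ν (g ⁻¹' {(x : ℝ≥0∞)}))).symm
  have hm : ∀ a : ℝ≥0∞, Measurable fun x => negExp (a * x) := fun a =>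
    continuous_negExp.measurable.comp (measurable_const_mul a)
  simp only [hsum, negExp_sum, div_eq_mul_inv, Finset.sum_mul]
  have hind := (h.indep _ _ hB hdisj).comp
    (fun k x => negExp (((e k : g.range) : ℝ≥0∞) * x)) (fun k => hm _)
  have hprod := lintegral_prod_eq_prod_lintegral_of_indepFun Finset.univ _ hind
    (fun k => (hm _).comp (h.measurable_pointMeasure (hB k)))
  simp only [Function.comp_def] at hprod
  rw [hprod]
  refine Finset.prod_le_prod' fun k _ => ?_
  rw [← div_eq_mul_inv]
  refine h.lintegral_negExp_mul_le (hB k) ?_ (hfin _)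
  obtain ⟨x, hx⟩ := SimpleFunc.mem_range.1 (e k).2
  rw [← hx]
  exact hg x

theorem lintegral_negExp_le (h : IsPoissonProcess Y μ P) [IsProbabilityMeasure P]
    {f : E → ℝ≥0∞} (hf : Measurable f) (hf1 : ∀ x, f x ≤ 1) (hμ : ∫⁻ x, f x ∂μ ≠ ∞) :
    ∫⁻ ω, negExp (∑' i, f (Y i ω)) ∂P ≤ negExp ((∫⁻ x, f x ∂μ) / 2) := by
  have hg : ∀ n x, SimpleFunc.eapprox f n x ≤ f x := fun n x => by
    rw [← SimpleFunc.iSup_eapprox_apply hf x]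
    exact le_iSup (fun n => SimpleFunc.eapprox f n x) n
  have hle : ∀ n, ∫⁻ ω, negExp (∑' i, f (Y i ω)) ∂P ≤
      negExp ((∫⁻ x, SimpleFunc.eapprox f n x ∂μ) / 2) := fun n => by
    refine (lintegral_mono fun ω => ?_).trans
      (h.lintegral_negExp_simpleFunc_le (SimpleFunc.eapprox f n) (fun x => (hg n x).trans (hf1 x))
        (ne_top_of_le_ne_top hμ (lintegral_mono (hg n))))
    rw [← lintegral_pointMeasure Y ω hf]
    exact negExp_antitone (lintegral_mono (hg n))
  refine ge_of_tendsto' (x := atTop)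
    (f := fun n => negExp ((∫⁻ x, SimpleFunc.eapprox f n x ∂μ) / 2)) ?_ hle
  refine (continuous_negExp.tendsto _).comp ?_
  refine ENNReal.Tendsto.div_const ?_ (Or.inr (by norm_num))
  refine lintegral_tendsto_of_tendsto_of_monotone (fun n => (SimpleFunc.measurable _).aemeasurable)
    (ae_of_all _ fun x n k hnk => SimpleFunc.monotone_eapprox f hnk x) (ae_of_all _ fun x => ?_)
  exact SimpleFunc.tendsto_eapprox hf x

/-- A substitute for the marking theorem. Given the points, the marks avoid `A` with probability `∏
(1 - f (Y i))`, where `f y` is the chance that the mark of `y` lands in `A`. This is at most `exp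
(-∑ f (Y i))`, whose mean is controlled by the Laplace functional. -/
theorem measure_forall_notMem_le (h : IsPoissonProcess Y μ P) [IsProbabilityMeasure P]
    {F : Type*} [MeasurableSpace F] {ξ : ℕ → Ω → F} {γ : Measure F} [IsProbabilityMeasure γ]
    (hY : IndepFun (fun ω i => Y i ω) (fun ω i => ξ i ω) P) (hξ : iIndepFun ξ P)
    (hlaw : ∀ i, HasLaw (ξ i) γ P) (hm : ∀ i, Measurable (ξ i)) {A : Set (E × F)}
    (hA : MeasurableSet A) (hμ : ∫⁻ y, γ (Prod.mk y ⁻¹' A) ∂μ ≠ ∞) :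
    P {ω | ∀ i, (Y i ω, ξ i ω) ∉ A} ≤ negExp ((∫⁻ y, γ (Prod.mk y ⁻¹' A) ∂μ) / 2) := by
  set f : E → ℝ≥0∞ := fun y => γ (Prod.mk y ⁻¹' A) with hf_def
  have hf : Measurable f := measurable_measure_prodMk_left hA
  refine le_trans ?_ (h.lintegral_negExp_le hf (fun y => prob_le_one) hμ)
  have hYm : Measurable fun ω i => Y i ω := measurable_pi_lambda _ h.measurable
  have hξm : Measurable fun ω i => ξ i ω := measurable_pi_lambda _ hm
  -- Only the first `n` marks are used, so that independence gives a finite product; `n → ∞` follows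
  -- by dominated convergence.
  have hle : ∀ n, P {ω | ∀ i, (Y i ω, ξ i ω) ∉ A} ≤
      ∫⁻ ω, negExp (∑ i ∈ Finset.range n, f (Y i ω)) ∂P := by
    intro n
    let C : Set ((ℕ → E) × (ℕ → F)) := {z | ∀ i ∈ Finset.range n, (z.1 i, z.2 i) ∈ Aᶜ}
    have hC : MeasurableSet C := by
      have : C = ⋂ i ∈ Finset.range n,
          (fun z : (ℕ → E) × (ℕ → F) => (z.1 i, z.2 i)) ⁻¹' Aᶜ := by
        ext z; simp [C]
      rw [this]
      refine Finset.measurableSet_biInter _ fun i _ => ?_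
      refine MeasurableSet.preimage hA.compl ?_
      fun_prop
    have hA' : ∀ y : E, MeasurableSet (Prod.mk y ⁻¹' A) := fun y =>
      hA.preimage measurable_prodMk_left
    calc P {ω | ∀ i, (Y i ω, ξ i ω) ∉ A}
        ≤ P ((fun ω => (fun i => Y i ω, fun i => ξ i ω)) ⁻¹' C) :=
          measure_mono fun ω hω i _ => hω i
      _ = ∫⁻ y, (P.map fun ω i => ξ i ω) (Prod.mk y ⁻¹' C) ∂(P.map fun ω i => Y i ω) := by
          rw [← Measure.map_apply (hYm.prodMk hξm) hC,
            (indepFun_iff_map_prod_eq_prod_map_map hYm.aemeasurable hξm.aemeasurable).1 hY,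
            Measure.prod_apply hC]
      _ ≤ ∫⁻ y, negExp (∑ i ∈ Finset.range n, f (y i)) ∂(P.map fun ω i => Y i ω) := by
          refine lintegral_mono fun y => ?_
          rw [Measure.map_apply hξm (hC.preimage measurable_prodMk_left), negExp_sum]
          have : (fun ω i => ξ i ω) ⁻¹' (Prod.mk y ⁻¹' C) =
              ⋂ i ∈ Finset.range n, ξ i ⁻¹' (Prod.mk (y i) ⁻¹' A)ᶜ := by
            ext ω; simp [C]
          rw [this, hξ.measure_inter_preimage_eq_mul _ (fun i _ => (hA' _).compl)]
          refine Finset.prod_le_prod' fun i _ => ?_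
          rw [← Measure.map_apply (hm i) (hA' _).compl, (hlaw i).map_eq,
            prob_compl_eq_one_sub (hA' _)]
          exact one_sub_le_negExp _
      _ = ∫⁻ ω, negExp (∑ i ∈ Finset.range n, f (Y i ω)) ∂P := by
          rw [lintegral_map _ hYm]
          exact continuous_negExp.measurable.comp
            (Finset.measurable_sum _ fun i _ => hf.comp (measurable_pi_apply i))
  refine ge_of_tendsto' (x := atTop) ?_ hle
  refine tendsto_lintegral_of_dominated_convergence (fun _ => 1)
    (fun n => continuous_negExp.measurable.comp
      (Finset.measurable_sum _ fun i _ => hf.comp (h.measurable i)))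
    (fun n => ae_of_all _ fun ω => negExp_le_one _) (by simp) (ae_of_all _ fun ω => ?_)
  exact (continuous_negExp.tendsto _).comp ENNReal.summable.hasSum.tendsto_sum_nat

end IsPoissonProcess

end Poisson

/-! ### Chaining for Brownian paths. -/

/-- Chernoff's bound at `x / v`, weakened by `exp u ≥ u ^ 2 / 2`. The power `v ^ 2` is what chaining
needs: with mesh `v` there are about `1 / v` increments, so the union bound still gains a factor
`v`. -/
theorem gaussianReal_Ici_le {v : ℝ≥0} (hv : v ≠ 0) {x : ℝ} (hx : 0 < x) :
    gaussianReal 0 v (Ici x) ≤ ENNReal.ofReal (8 * v ^ 2 / x ^ 4) := by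
  have hv' : (0 : ℝ) < v := by positivity
  have h := measure_ge_le_exp_mul_mgf (μ := gaussianReal 0 v) (X := id) (t := x / v) x
    (by positivity) (integrable_exp_mul_gaussianReal _)
  rw [congrFun mgf_id_gaussianReal, ← Real.exp_add] at h
  have h2 : gaussianReal 0 v (Ici x) = ENNReal.ofReal ((gaussianReal 0 v).real {ω | x ≤ id ω}) := by
    rw [ofReal_measureReal]; rfl
  rw [h2]
  refine ENNReal.ofReal_le_ofReal (h.trans ?_)
  have h3 : -(x / v) * x + (0 * (x / v) + v * (x / v) ^ 2 / 2) = -(x ^ 2 / (2 * v)) := by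
    field_simp
    ring
  rw [h3, Real.exp_neg]
  have h4 := Real.pow_div_factorial_le_exp (x ^ 2 / (2 * v)) (by positivity) 2
  calc (Real.exp (x ^ 2 / (2 * v)))⁻¹ ≤ ((x ^ 2 / (2 * v)) ^ 2 / (2).factorial)⁻¹ := by gcongr
    _ = 8 * v ^ 2 / x ^ 4 := by
      simp only [Nat.factorial]
      push_cast
      field_simp
      ring

section Real

variable {Ω : Type*} [MeasurableSpace Ω] {P : Measure Ω} {B : ℝ≥0 → Ω → ℝ}

theorem measure_abs_sub_gt_le (hB : IsPreBrownianReal B P) {s t : ℝ≥0} (hst : s ≠ t) {x : ℝ}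
    (hx : 0 < x) :
    P {ω | x < |B s ω - B t ω|} ≤ ENNReal.ofReal (16 * dist s t ^ 2 / x ^ 4) := by
  have key : ∀ s t : ℝ≥0, s ≠ t →
      P {ω | x ≤ B s ω - B t ω} ≤ ENNReal.ofReal (8 * dist s t ^ 2 / x ^ 4) := by
    intro s t hst
    have h := (hB.hasLaw_sub s t).measure_eq (p := fun y => x ≤ y) measurableSet_Ici
    simp only [Pi.sub_apply] at h
    rw [h]
    refine (gaussianReal_Ici_le ?_ hx).trans (by rfl)
    exact fun h0 => hst (NNReal.eq (nndist_eq_zero.1 h0))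
  calc P {ω | x < |B s ω - B t ω|}
      ≤ P ({ω | x ≤ B s ω - B t ω} ∪ {ω | x ≤ B t ω - B s ω}) := by
        refine measure_mono fun ω hω => ?_
        rcases lt_abs.1 (show x < |B s ω - B t ω| from hω) with h | h
        · exact Or.inl h.le
        · right; show x ≤ B t ω - B s ω; linarith
    _ ≤ _ := measure_union_le _ _
    _ ≤ _ := add_le_add (key s t hst) (key t s hst.symm)
    _ = _ := by
      rw [dist_comm t s, ← ENNReal.ofReal_add (by positivity) (by positivity)]
      congr 1
      ring

/-- The largest multiple of `1 / N` that is at most `s`. -/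
noncomputable def gridFloor (N : ℕ) (s : ℝ≥0) : ℝ≥0 := ⌊N * s⌋₊ / N

/-- Functions having, for some `n`, a large increment between neighbouring points of the grid of
mesh `1 / (T * 2 ^ (n + 1))` in `[0, 1]`. -/
def roughFunctions (T : ℕ) (ε : ℝ) : Set (ℝ≥0 → ℝ) :=
  ⋃ n : ℕ, ⋃ k ∈ Finset.range (T * 2 ^ (n + 1)),
    {f | ε * (9 / 10) ^ n < |f ((k + 1 : ℕ) / (T * 2 ^ (n + 1) : ℕ)) -
      f ((k : ℕ) / (T * 2 ^ (n + 1) : ℕ))|}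

theorem measurableSet_roughFunctions (T : ℕ) (ε : ℝ) : MeasurableSet (roughFunctions T ε) := by
  refine MeasurableSet.iUnion fun n => Finset.measurableSet_biUnion _ fun k _ => ?_
  exact measurableSet_lt measurable_const (by fun_prop)

theorem measure_roughFunctions_le (hB : IsPreBrownianReal B P) {T : ℕ} (hT : T ≠ 0) {ε : ℝ}
    (hε : 0 < ε) :
    P {ω | (fun t => B t ω) ∈ roughFunctions T ε} ≤ ENNReal.ofReal (40 / (T * ε ^ 4)) := by
  have hT' : (0 : ℝ) < T := by positivity
  have hlevel : ∀ n : ℕ, P {ω | ∃ k ∈ Finset.range (T * 2 ^ (n + 1)),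
      ε * (9 / 10) ^ n < |B ((k + 1 : ℕ) / (T * 2 ^ (n + 1) : ℕ)) ω -
        B ((k : ℕ) / (T * 2 ^ (n + 1) : ℕ)) ω|} ≤
      ENNReal.ofReal (8 / (T * ε ^ 4) * (4 / 5) ^ n) := by
    intro n
    have hset : {ω | ∃ k ∈ Finset.range (T * 2 ^ (n + 1)),
      ε * (9 / 10) ^ n < |B ((k + 1 : ℕ) / (T * 2 ^ (n + 1) : ℕ)) ω -
        B ((k : ℕ) / (T * 2 ^ (n + 1) : ℕ)) ω|} = ⋃ k ∈ Finset.range (T * 2 ^ (n + 1)),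
        {ω | ε * (9 / 10) ^ n < |B ((k + 1 : ℕ) / (T * 2 ^ (n + 1) : ℕ)) ω -
        B ((k : ℕ) / (T * 2 ^ (n + 1) : ℕ)) ω|} := by
      ext; simp
    rw [hset]
    have hN : ((T * 2 ^ (n + 1) : ℕ) : ℝ≥0) ≠ 0 := by positivity
    have hd : ∀ k : ℕ, dist (((k + 1 : ℕ) : ℝ≥0) / (T * 2 ^ (n + 1) : ℕ))
        ((k : ℝ≥0) / (T * 2 ^ (n + 1) : ℕ)) = 1 / (T * 2 ^ (n + 1)) := by
      intro k
      rw [NNReal.dist_eq]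
      push_cast
      rw [← sub_div, add_sub_cancel_left, abs_of_pos (by positivity)]
    refine (measure_biUnion_finset_le _ _).trans
      ((Finset.sum_le_sum fun k _ => measure_abs_sub_gt_le hB ?_ (by positivity)).trans ?_)
    · intro h
      have := hd k
      rw [h, dist_self] at this
      exact absurd this (by positivity)
    simp only [hd, Finset.sum_const, Finset.card_range, nsmul_eq_mul]
    rw [← ENNReal.ofReal_natCast, ← ENNReal.ofReal_mul (by positivity)]
    refine ENNReal.ofReal_le_ofReal ?_
    -- Each level doubles the number of increments, quarters the squared variance and multiplies the
    -- fourth power of the threshold by `(9 / 10) ^ 4`. The ratio is `1 / (2 * (9 / 10) ^ 4) = 5000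
    -- / 6561 < 4 / 5`.
    have h1 : ((T * 2 ^ (n + 1) : ℕ) : ℝ) *
        (16 * (1 / (T * 2 ^ (n + 1))) ^ 2 / (ε * (9 / 10) ^ n) ^ 4) =
        8 / (T * ε ^ 4) * (5000 / 6561) ^ n := by
      have : ((5000 : ℝ) / 6561) ^ n = 1 / (2 ^ n * ((9 / 10) ^ n) ^ 4) := by
        rw [← pow_mul, mul_comm n 4, pow_mul, ← mul_pow, ← one_div_pow]
        norm_num
      rw [this]
      push_cast
      field_simp
      ring
    rw [h1]
    exact mul_le_mul_of_nonneg_left (pow_le_pow_left₀ (by norm_num) (by norm_num) n)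
      (by positivity)
  have hset : {ω | (fun t => B t ω) ∈ roughFunctions T ε} = ⋃ n : ℕ,
      {ω | ∃ k ∈ Finset.range (T * 2 ^ (n + 1)),
      ε * (9 / 10) ^ n < |B ((k + 1 : ℕ) / (T * 2 ^ (n + 1) : ℕ)) ω -
        B ((k : ℕ) / (T * 2 ^ (n + 1) : ℕ)) ω|} := by
    ext; simp [roughFunctions]
  rw [hset]
  refine (measure_iUnion_le _).trans ((ENNReal.tsum_le_tsum hlevel).trans ?_)
  have hs : HasSum (fun n : ℕ => 8 / (T * ε ^ 4) * (4 / 5 : ℝ) ^ n)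
      (8 / (T * ε ^ 4) * (1 - 4 / 5)⁻¹) :=
    (hasSum_geometric_of_lt_one (by norm_num) (by norm_num)).mul_left _
  rw [← ENNReal.ofReal_tsum_of_nonneg (fun n => by positivity) hs.summable, hs.tsum_eq]
  refine ENNReal.ofReal_le_ofReal (le_of_eq ?_)
  field_simp
  norm_num

end Real

theorem tendsto_gridFloor {T : ℕ} (hT : T ≠ 0) (s : ℝ≥0) :
    Tendsto (fun n : ℕ => gridFloor (T * 2 ^ n) s) atTop (𝓝 s) := by
  have h1 : Tendsto (fun n : ℕ => ((T * 2 ^ n : ℕ) : ℝ)) atTop atTop := by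
    push_cast
    exact (tendsto_pow_atTop_atTop_of_one_lt (by norm_num)).const_mul_atTop (by positivity)
  have h2 := (tendsto_nat_floor_mul_div_atTop s.2).comp h1
  rw [← NNReal.tendsto_coe]
  refine h2.congr fun n => ?_
  simp only [Function.comp_apply, gridFloor, NNReal.coe_div, NNReal.coe_natCast]
  congr 2
  rw [mul_comm]
  exact Nonneg.nat_floor_coe (α := ℝ) (((T * 2 ^ n : ℕ) : ℝ≥0) * s)

/-- Doubling the grid leaves the floor of `s` in place or moves it by one finer mesh step, which
costs at most `ε * (9 / 10) ^ n`. The series sums to `10 * ε`, and continuity identifies the limit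
with `f s`. -/
theorem abs_sub_gridFloor_le {T : ℕ} (hT : T ≠ 0) {ε : ℝ} (hε : 0 ≤ ε) {f : ℝ≥0 → ℝ}
    (hf : Continuous f) (hr : f ∉ roughFunctions T ε) {s : ℝ≥0} (hs : s ≤ 1) :
    |f s - f (gridFloor T s)| ≤ 10 * ε := by
  have hr' : ∀ n k : ℕ, k < T * 2 ^ (n + 1) →
      |f ((k + 1 : ℕ) / (T * 2 ^ (n + 1) : ℕ)) - f ((k : ℕ) / (T * 2 ^ (n + 1) : ℕ))| ≤
        ε * (9 / 10) ^ n := by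
    simpa [roughFunctions] using hr
  have hstep : ∀ n, dist (f (gridFloor (T * 2 ^ n) s)) (f (gridFloor (T * 2 ^ (n + 1)) s)) ≤
      ε * (9 / 10) ^ n := by
    intro n
    set x : ℝ≥0 := (T * 2 ^ n : ℕ) * s with hx
    have hx2 : ((T * 2 ^ (n + 1) : ℕ) : ℝ≥0) * s = 2 * x := by rw [hx]; push_cast; ring
    have hfl : gridFloor (T * 2 ^ n) s = ((2 * ⌊x⌋₊ : ℕ) : ℝ≥0) / (T * 2 ^ (n + 1) : ℕ) := by
      rw [gridFloor, ← hx]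
      have : ((T : ℝ≥0)) ≠ 0 := by positivity
      push_cast
      field_simp
      ring
    have h1 : 2 * ⌊x⌋₊ ≤ ⌊2 * x⌋₊ := by
      refine Nat.le_floor ?_
      push_cast
      gcongr
      exact Nat.floor_le zero_le
    have h2 : ⌊2 * x⌋₊ < 2 * ⌊x⌋₊ + 2 := by
      rw [Nat.floor_lt zero_le]
      have := Nat.lt_floor_add_one x
      push_cast
      calc 2 * x < 2 * (⌊x⌋₊ + 1) := by gcongr
        _ = _ := by ring
    have h3 : ⌊2 * x⌋₊ ≤ T * 2 ^ (n + 1) := by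
      rw [← hx2]
      refine Nat.floor_le_of_le ?_
      calc ((T * 2 ^ (n + 1) : ℕ) : ℝ≥0) * s ≤ (T * 2 ^ (n + 1) : ℕ) * 1 := by gcongr
        _ = _ := mul_one _
    rw [hfl, gridFloor, hx2]
    rcases Nat.lt_or_ge (2 * ⌊x⌋₊) ⌊2 * x⌋₊ with h | h
    · have h4 : ⌊2 * x⌋₊ = 2 * ⌊x⌋₊ + 1 := by omega
      rw [h4, dist_comm]
      exact hr' n _ (by omega)
    · rw [le_antisymm h h1, dist_self]
      positivity
  have h := dist_le_of_le_geometric_of_tendsto₀ (9 / 10) ε (by norm_num) hstep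
    ((hf.tendsto s).comp (tendsto_gridFloor hT s))
  rw [dist_comm, Real.dist_eq, pow_zero, mul_one] at h
  exact h.trans (le_of_eq (by ring))

/-! ### Deterministic coverage criteria on a grid of cells. -/

section Geometry

variable {m : ℕ}

/-- The cubes of side `1 / n` of the grid in `[0,1)^m`. -/
def cell (n : ℕ) (k : Fin m → Fin n) : Set (EuclideanSpace ℝ (Fin m)) :=
  {y | ∀ j, y j ∈ Ico ((k j : ℝ) / n) (((k j : ℝ) + 1) / n)}

theorem setOf_forall_mem_eq_preimage (I : Fin m → Set ℝ) :
    {y : EuclideanSpace ℝ (Fin m) | ∀ j, y j ∈ I j} =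
      (MeasurableEquiv.toLp 2 (Fin m → ℝ)).symm ⁻¹' (univ.pi I) := by
  ext y; simp

theorem measurableSet_setOf_forall_mem {I : Fin m → Set ℝ} (hI : ∀ j, MeasurableSet (I j)) :
    MeasurableSet {y : EuclideanSpace ℝ (Fin m) | ∀ j, y j ∈ I j} := by
  rw [setOf_forall_mem_eq_preimage]
  exact (MeasurableEquiv.measurable _) (MeasurableSet.univ_pi hI)

theorem volume_setOf_forall_mem {I : Fin m → Set ℝ} (hI : ∀ j, MeasurableSet (I j)) :
    volume {y : EuclideanSpace ℝ (Fin m) | ∀ j, y j ∈ I j} = ∏ j, volume (I j) := by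
  rw [setOf_forall_mem_eq_preimage,
    (EuclideanSpace.volume_preserving_symm_measurableEquiv_toLp (Fin m)).measure_preimage
      (MeasurableSet.univ_pi hI).nullMeasurableSet, volume_pi_pi]

theorem measurableSet_cell (n : ℕ) (k : Fin m → Fin n) : MeasurableSet (cell n k) :=
  measurableSet_setOf_forall_mem fun _ => measurableSet_Ico

theorem volume_cell (n : ℕ) (k : Fin m → Fin n) :
    volume (cell n k) = ENNReal.ofReal ((1 / n) ^ m) := by
  rw [cell, volume_setOf_forall_mem fun _ => measurableSet_Ico]
  simp only [Real.volume_Ico, ← sub_div, add_sub_cancel_left, Finset.prod_const, Finset.card_univ,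
    Fintype.card_fin]
  rw [ENNReal.ofReal_pow (by positivity)]

theorem measurableSet_base (m : ℕ) : MeasurableSet (base m) :=
  measurableSet_setOf_forall_mem fun _ => measurableSet_Icc

theorem volume_base (m : ℕ) : volume (base m) = 1 := by
  rw [base, volume_setOf_forall_mem fun _ => measurableSet_Icc]
  simp

theorem disjoint_cell {n : ℕ} {k l : Fin m → Fin n} (hkl : k ≠ l) :
    Disjoint (cell n k) (cell n l) := by
  rw [Set.disjoint_left]
  intro y hk hl
  apply hkl
  ext j
  have hn : (0 : ℝ) < n := by
    have := (k j).pos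
    exact_mod_cast this
  have h1 := hk j
  have h2 := hl j
  rw [mem_Ico, div_le_iff₀ hn, lt_div_iff₀ hn] at h1 h2
  have h3 : ((k j : ℕ) : ℝ) < (l j : ℕ) + 1 := h1.1.trans_lt h2.2
  have h4 : ((l j : ℕ) : ℝ) < (k j : ℕ) + 1 := h2.1.trans_lt h1.2
  have h5 : (k j : ℕ) < (l j : ℕ) + 1 := by exact_mod_cast h3
  have h6 : (l j : ℕ) < (k j : ℕ) + 1 := by exact_mod_cast h4
  omega

theorem norm_le_card_mul {y : EuclideanSpace ℝ (Fin m)} {δ : ℝ} (hδ : 0 ≤ δ)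
    (h : ∀ j, |y j| ≤ δ) : ‖y‖ ≤ m * δ := by
  rw [EuclideanSpace.norm_eq]
  refine Real.sqrt_le_iff.2 ⟨by positivity, ?_⟩
  calc ∑ j, ‖y j‖ ^ 2 ≤ ∑ _j : Fin m, δ ^ 2 := by
        gcongr with j
        exact h j
    _ = m * δ ^ 2 := by simp
    _ ≤ (m * m) * δ ^ 2 := by
        gcongr
        exact_mod_cast Nat.le_mul_self m
    _ = (m * δ) ^ 2 := by ring

theorem smul_flatBall {r : ℝ} (hr : 0 < r) : r • flatBall m 1 = flatBall m r := by
  ext ⟨y, t⟩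
  simp only [flatBall, mem_smul_set_iff_inv_smul_mem₀ hr.ne', mem_prod, Prod.smul_mk,
    mem_singleton_iff, smul_eq_mul, mem_closedBall_zero_iff, norm_smul, norm_inv, Real.norm_eq_abs,
    abs_of_pos hr, mul_eq_zero, inv_eq_zero, hr.ne', false_or]
  rw [inv_mul_le_iff₀ hr, mul_one]

/-- Cells are half-open, so a point with a coordinate equal to `1` lies in none; it is served by the
last cell in that direction. -/
theorem exists_forall_mem_cell_abs_sub_le {n : ℕ} (hn : n ≠ 0) {x : EuclideanSpace ℝ (Fin m)}
    (hx : x ∈ base m) :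
    ∃ k : Fin m → Fin n, ∀ y ∈ cell n k, ∀ j, |x j - y j| ≤ 1 / n := by
  have hn' : (0 : ℝ) < n := by positivity
  have h : ∀ j, ∃ k : Fin n, (k : ℝ) / n ≤ x j ∧ x j ≤ ((k : ℝ) + 1) / n := by
    intro j
    obtain ⟨h0, h1⟩ := hx j
    simp only [div_le_iff₀ hn', le_div_iff₀ hn']
    rcases h1.lt_or_eq with h1 | h1
    · have hlt : x j * n < n := by nlinarith
      refine ⟨⟨⌊x j * n⌋₊, (Nat.floor_lt (by positivity)).2 hlt⟩, Nat.floor_le (by positivity), ?_⟩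
      exact (Nat.lt_floor_add_one _).le
    · refine ⟨⟨n - 1, by omega⟩, ?_⟩
      rw [h1]
      simp [Nat.cast_sub (Nat.one_le_iff_ne_zero.2 hn)]
  choose k hk using h
  refine ⟨k, fun y hy j => ?_⟩
  have h1 := hy j
  have h2 := hk j
  rw [mem_Ico] at h1
  rw [add_div] at h1 h2
  rw [abs_le]
  constructor <;> linarith

/-- To cover `(x, t)`, take a cell next to `x` and a particle in it at the last grid time before
`t`. Coordinatewise the cell costs `1 / n` and the motion up to `t` costs `10 * ε`. The factor `m +
1`, rather than `m`, keeps the radius positive when `m = 0`. -/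
theorem coverageRadius_le {n T : ℕ} (hn : n ≠ 0) (hT : T ≠ 0) {ε : ℝ} (hε : 0 ≤ ε)
    {y : ℕ → EuclideanSpace ℝ (Fin m)} {w : ℕ → ℝ≥0 → EuclideanSpace ℝ (Fin m)}
    (hc : ∀ i j, Continuous fun t => w i t j)
    (hr : ∀ i, y i ∈ base m → ∀ j, (fun t => w i t j) ∉ roughFunctions T ε)
    (hcell : ∀ l ≤ T, ∀ k : Fin m → Fin n, ∃ i, y i ∈ base m ∧ y i + w i (l / T) ∈ cell n k) :
    coverageRadius y (fun i t => y i + w i t) (flatBall m 1) ≤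
      ENNReal.ofReal ((m + 1) * (1 / n + 10 * ε)) := by
  have hn' : (0 : ℝ) < n := by positivity
  have hr0 : (0 : ℝ) < (m + 1) * (1 / n + 10 * ε) := by positivity
  refine iInf₂_le (((m + 1) * (1 / n + 10 * ε) : ℝ).toNNReal) ?_
  rw [Real.coe_toNNReal _ hr0.le, smul_flatBall hr0]
  rintro ⟨x, t⟩ ⟨hx, ht0, ht1⟩
  simp only at hx ht0 ht1
  obtain ⟨k, hk⟩ := exists_forall_mem_cell_abs_sub_le hn hx
  lift t to ℝ≥0 using ht0
  have ht1 : t ≤ 1 := by exact_mod_cast ht1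
  have hl : ⌊(T : ℝ≥0) * t⌋₊ ≤ T := by
    refine Nat.floor_le_of_le ?_
    calc (T : ℝ≥0) * t ≤ T * 1 := by gcongr
      _ = T := mul_one _
  obtain ⟨i, hi, hik⟩ := hcell _ hl k
  refine mem_iUnion₂.2 ⟨i, hi, ?_⟩
  refine ⟨(y i + w i t, t), ⟨t, rfl⟩, (x - (y i + w i t), 0), ⟨?_, rfl⟩, by simp⟩
  rw [mem_closedBall_zero_iff]
  refine (norm_le_card_mul (δ := 1 / n + 10 * ε) (by positivity) fun j => ?_).trans ?_
  · have h1 := hk _ hik j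
    have h2 := abs_sub_gridFloor_le hT hε (hc i j) (hr i hi j) ht1
    rw [abs_le] at h1 h2 ⊢
    simp only [gridFloor, PiLp.add_apply, PiLp.sub_apply] at h1 h2 ⊢
    constructor <;> linarith
  · gcongr
    linarith

theorem exists_mem_cell_of_subset_cylinderSet {n : ℕ} {r : ℝ≥0}
    (hr : (r : ℝ) < 1 / (2 * n)) {y : ℕ → EuclideanSpace ℝ (Fin m)}
    {x : ℕ → ℝ≥0 → EuclideanSpace ℝ (Fin m)} (hx : ∀ i, x i 0 = y i)
    (hcov : unitCube m ⊆ cylinderSet y x ((r : ℝ) • flatBall m 1)) (k : Fin m → Fin n) :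
    ∃ i, y i ∈ cell n k := by
  have hn : ∀ j, (0 : ℝ) < n := fun j => by
    have := (k j).pos
    exact_mod_cast this
  let z : EuclideanSpace ℝ (Fin m) := WithLp.toLp 2 fun j => ((k j : ℝ) + 1 / 2) / n
  have hz : (z, (0 : ℝ)) ∈ unitCube m := by
    refine ⟨fun j => ⟨?_, ?_⟩, by simp⟩
    · have := hn j
      simp only [z]
      positivity
    · simp only [z]
      rw [div_le_one (hn j)]
      have : ((k j : ℕ) : ℝ) + 1 ≤ n := by exact_mod_cast (k j).2
      linarith
  obtain ⟨i, -, p, ⟨u, rfl⟩, q, hq, hpq⟩ := mem_iUnion₂.1 (hcov hz)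
  obtain ⟨⟨v, s⟩, ⟨hv, hs⟩, rfl⟩ := hq
  simp only [mem_closedBall_zero_iff, mem_singleton_iff] at hv hs
  subst hs
  simp only [Prod.smul_mk, smul_zero, Prod.mk_add_mk, add_zero, Prod.mk.injEq,
    NNReal.coe_eq_zero] at hpq
  -- Flatness enters here: the point has time coordinate `0`, so the trajectory covering it does so
  -- from its position at time `0`.
  obtain ⟨h1, rfl⟩ := hpq
  refine ⟨i, fun j => ?_⟩
  have h2 : |z j - y i j| ≤ r := by
    have : z - y i = (r : ℝ) • v := by rw [← h1, hx, add_sub_cancel_left]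
    calc |z j - y i j| = ‖(z - y i) j‖ := rfl
      _ ≤ ‖z - y i‖ := PiLp.norm_apply_le _ j
      _ ≤ r := by
        rw [this, norm_smul, Real.norm_eq_abs, NNReal.abs_eq]
        exact mul_le_of_le_one_right r.2 hv
  have h3 : z j = (k j : ℝ) / n + 1 / (2 * n) := by
    have := hn j
    simp only [z]
    field_simp
  have h4 : ((k j : ℝ) + 1) / n = (k j : ℝ) / n + 1 / (2 * n) + 1 / (2 * n) := by
    have := hn j
    field_simp
    ring
  rw [h3, abs_le] at h2
  rw [h4]
  constructor <;> linarith

end Geometry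

/-! ### Hitting intensity of a cell. -/

section Gaussian

/-- A lower bound for the mass that centred Gaussian measures of variance at most `1` give to
`[0, 1/4]` and to `[-1/4, 0]`. -/
noncomputable def gaussianQuarter : ℝ≥0∞ :=
  min (gaussianReal 0 1 (Icc 0 (1 / 4))) (gaussianReal 0 1 (Icc (-(1 / 4)) 0))

theorem gaussianQuarter_pos : 0 < gaussianQuarter := by
  have h : ∀ a b : ℝ, a < b → 0 < gaussianReal 0 1 (Icc a b) := by
    intro a b hab
    rw [pos_iff_ne_zero]
    intro h
    have := gaussianReal_absolutelyContinuous' 0 one_ne_zero h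
    rw [Real.volume_Icc, ENNReal.ofReal_eq_zero] at this
    linarith
  exact lt_min (h _ _ (by norm_num)) (h _ _ (by norm_num))

theorem gaussianQuarter_le_one : gaussianQuarter ≤ 1 := (min_le_left _ _).trans prob_le_one

/-- Variance `t` arises from variance `1` by scaling with `√t ≤ 1`, which maps a set star-shaped
about `0` into itself. This makes the bound uniform down to `t = 0`. -/
theorem gaussianReal_one_le {t : ℝ≥0} (ht : t ≤ 1) {s : Set ℝ} (hs : MeasurableSet s)
    (hstar : ∀ x ∈ s, ∀ c ∈ Icc (0 : ℝ) 1, c * x ∈ s) :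
    gaussianReal 0 1 s ≤ gaussianReal 0 t s := by
  have h := gaussianReal_map_const_mul (μ := 0) (v := 1) (NNReal.sqrt t)
  have hv : NNReal.mk ((NNReal.sqrt t : ℝ) ^ 2) (sq_nonneg _) * 1 = t := by
    ext
    simp
  rw [hv, mul_zero] at h
  rw [← h, Measure.map_apply (by fun_prop) hs]
  refine measure_mono fun x hx => hstar x hx _ ⟨NNReal.coe_nonneg _, ?_⟩
  exact_mod_cast NNReal.sqrt_le_one.2 ht

theorem gaussianQuarter_le {t : ℝ≥0} (ht : t ≤ 1) :
    gaussianQuarter ≤ gaussianReal 0 t (Icc 0 (1 / 4)) ∧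
      gaussianQuarter ≤ gaussianReal 0 t (Icc (-(1 / 4)) 0) := by
  refine ⟨(min_le_left _ _).trans (gaussianReal_one_le ht measurableSet_Icc ?_),
    (min_le_right _ _).trans (gaussianReal_one_le ht measurableSet_Icc ?_)⟩
  · rintro x ⟨h0, h1⟩ c ⟨c0, c1⟩
    constructor <;> nlinarith
  · rintro x ⟨h0, h1⟩ c ⟨c0, c1⟩
    constructor <;> nlinarith

variable {m : ℕ}

/-- The law at time `t` of standard Brownian motion in `ℝ^m`. -/
noncomputable def heatMeasure (m : ℕ) (t : ℝ≥0) : Measure (EuclideanSpace ℝ (Fin m)) :=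
  (Measure.pi fun _ : Fin m => gaussianReal 0 t).map (MeasurableEquiv.toLp 2 (Fin m → ℝ))

instance (m : ℕ) (t : ℝ≥0) : IsProbabilityMeasure (heatMeasure m t) :=
  Measure.isProbabilityMeasure_map (MeasurableEquiv.measurable _).aemeasurable

theorem heatMeasure_setOf_forall_mem (t : ℝ≥0) {I : Fin m → Set ℝ}
    (hI : ∀ j, MeasurableSet (I j)) :
    heatMeasure m t {y | ∀ j, y j ∈ I j} = ∏ j, gaussianReal 0 t (I j) := by
  rw [heatMeasure, Measure.map_apply (MeasurableEquiv.measurable _)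
    (measurableSet_setOf_forall_mem hI), ← Measure.pi_pi]
  congr 1
  ext y
  simp

theorem IsBrownian.hasLaw {Ω : Type*} [MeasurableSpace Ω] {P : Measure Ω}
    {W : ℝ≥0 → Ω → EuclideanSpace ℝ (Fin m)} (hW : IsBrownian W P) (t : ℝ≥0) :
    HasLaw (W t) (heatMeasure m t) P := by
  have h := iIndepFun.hasLaw_pi (fun j => (hW.isBrownianReal j).hasLaw_eval t)
    (hW.indep.comp (fun _ f => f t) fun _ => measurable_pi_apply t)
  refine ⟨(hW.measurable t).aemeasurable, ?_⟩
  rw [heatMeasure, ← h.map_eq,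
    Measure.map_map (MeasurableEquiv.measurable _) ?_]
  · rfl
  · refine measurable_pi_lambda _ fun j => ?_
    have := hW.measurable t
    fun_prop

/-- Starting points in `[0,1]^m` and displacements leading to the cell `k`. -/
def hitSet (n : ℕ) (k : Fin m → Fin n) :
    Set (EuclideanSpace ℝ (Fin m) × EuclideanSpace ℝ (Fin m)) :=
  {z | z.1 ∈ base m ∧ z.1 + z.2 ∈ cell n k}

theorem measurableSet_hitSet (n : ℕ) (k : Fin m → Fin n) : MeasurableSet (hitSet n k) :=
  (measurable_fst (measurableSet_base m)).inter
    ((measurable_fst.add measurable_snd) (measurableSet_cell n k))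

theorem lintegral_heatMeasure_hitSet_ne_top (t : ℝ≥0) (n : ℕ) (k : Fin m → Fin n) :
    ∫⁻ y, heatMeasure m t (Prod.mk y ⁻¹' hitSet n k) ≠ ∞ := by
  rw [← Measure.prod_apply (measurableSet_hitSet n k)]
  refine ne_top_of_le_ne_top ?_
    (measure_mono (t := base m ×ˢ univ) fun z hz => ⟨hz.1, mem_univ _⟩)
  rw [Measure.prod_prod, volume_base, measure_univ]
  simp

/-- Integrate over the starting point first: for a fixed displacement `w`, the points carried into
the cell form a translate of it, of the same volume. It stays inside the cube if each `w j` has size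
at most `1 / 4` and a sign suited to the position of the cell. -/
theorem le_lintegral_heatMeasure_hitSet {t : ℝ≥0} (ht : t ≤ 1) {n : ℕ} (hn : 2 ≤ n)
    (k : Fin m → Fin n) :
    gaussianQuarter ^ m * ENNReal.ofReal ((1 / n) ^ m) ≤
      ∫⁻ y, heatMeasure m t (Prod.mk y ⁻¹' hitSet n k) := by
  classical
  -- Starting points are `cell - w`. If the cell begins at `1 / 4` or later, shifting down by at
  -- most `1 / 4` is safe; otherwise it ends before `1 / 4 + 1 / n ≤ 3 / 4`, and shifting up is
  -- safe.
  let I : Fin m → Set ℝ := fun j =>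
    if 1 / 4 ≤ (k j : ℝ) / n then Icc 0 (1 / 4) else Icc (-(1 / 4)) 0
  have hI : ∀ j, MeasurableSet (I j) := fun j => by
    simp only [I]
    split_ifs <;> exact measurableSet_Icc
  have hmass : gaussianQuarter ^ m ≤ heatMeasure m t {w | ∀ j, w j ∈ I j} := by
    rw [heatMeasure_setOf_forall_mem t hI]
    calc gaussianQuarter ^ m = ∏ _j : Fin m, gaussianQuarter := by simp
      _ ≤ _ := Finset.prod_le_prod' fun j _ => by
        simp only [I]
        split_ifs
        · exact (gaussianQuarter_le ht).1
        · exact (gaussianQuarter_le ht).2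
  have hn' : (2 : ℝ) ≤ n := by exact_mod_cast hn
  have hbase : ∀ w ∈ {w : EuclideanSpace ℝ (Fin m) | ∀ j, w j ∈ I j}, ∀ y,
      y + w ∈ cell n k → y ∈ base m := by
    intro w hw y hy j
    have h1 := hy j
    have h2 := hw j
    have h3 : ((k j : ℝ) + 1) / n ≤ 1 := by
      rw [div_le_one (by linarith)]
      exact_mod_cast (k j).2
    have h4 : (0 : ℝ) ≤ (k j : ℝ) / n := by positivity
    have h5 : (1 : ℝ) / n ≤ 1 / 2 := by gcongr
    rw [add_div, mem_Ico, PiLp.add_apply] at h1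
    rw [add_div] at h3
    simp only [I] at h2
    split_ifs at h2 with h
    · constructor <;> linarith [h2.1, h2.2]
    · constructor <;> linarith [h2.1, h2.2]
  rw [← Measure.prod_apply (measurableSet_hitSet n k),
    Measure.prod_apply_symm (measurableSet_hitSet n k)]
  calc gaussianQuarter ^ m * ENNReal.ofReal ((1 / n) ^ m)
      ≤ ENNReal.ofReal ((1 / n) ^ m) * heatMeasure m t {w | ∀ j, w j ∈ I j} := by
        rw [mul_comm]
        gcongr
    _ = ∫⁻ _w in {w | ∀ j, w j ∈ I j}, ENNReal.ofReal ((1 / n) ^ m) ∂heatMeasure m t := by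
        rw [setLIntegral_const]
    _ ≤ ∫⁻ w in {w | ∀ j, w j ∈ I j},
          volume ((fun y => (y, w)) ⁻¹' hitSet n k) ∂heatMeasure m t := by
        refine setLIntegral_mono' (measurableSet_setOf_forall_mem hI) fun w hw => ?_
        rw [← volume_cell n k, ← measure_preimage_add_right volume w (cell n k)]
        exact measure_mono fun y hy => ⟨hbase w hw y hy, hy⟩
    _ ≤ _ := setLIntegral_le_lintegral _ _

end Gaussian

/-! ### Probability bounds at a fixed intensity. -/

namespace IsBrownianModel

variable {Ω : Type*} [MeasurableSpace Ω] {P : Measure Ω} {m : ℕ} {ρ : ℝ}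
  {Y : ℕ → Ω → EuclideanSpace ℝ (Fin m)} {W : ℕ → ℝ≥0 → Ω → EuclideanSpace ℝ (Fin m)}

theorem measure_coverageRadius_lt_le (h : IsBrownianModel ρ Y W P) (hρ : 0 ≤ ρ) (n : ℕ) :
    P {ω | brownianCoverageRadius Y W (flatBall m 1) ω < ENNReal.ofReal (1 / (2 * n))} ≤
      ENNReal.ofReal ((1 - Real.exp (-(ρ * (1 / n) ^ m))) ^ (n ^ m)) := by
  have hvol : ∀ k : Fin m → Fin n, (ENNReal.ofReal ρ • volume) (cell n k) =
      ENNReal.ofReal (ρ * (1 / n) ^ m) := fun k => by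
    rw [Measure.smul_apply, volume_cell, smul_eq_mul, ← ENNReal.ofReal_mul hρ]
  let e := (Fintype.equivFin (Fin m → Fin n)).symm
  have h0 : ∀ᵐ ω ∂P, ∀ i, W i 0 ω = 0 := by
    rw [ae_all_iff]
    intro i
    have := fun j => ((h.brownian i).isBrownianReal j).eval_zero_ae_eq_zero
    filter_upwards [ae_all_iff.2 this] with ω hω
    ext j
    exact hω j
  have hind := h.poisson.indep _ (fun k => cell n (e k)) (fun k => measurableSet_cell n _)
    (fun k l hkl => disjoint_cell (e.injective.ne hkl))
  calc P {ω | brownianCoverageRadius Y W (flatBall m 1) ω < ENNReal.ofReal (1 / (2 * n))}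
      ≤ P (⋂ k ∈ Finset.univ, (fun ω => pointMeasure Y ω (cell n (e k))) ⁻¹' {0}ᶜ) := by
        refine measure_mono_ae ?_
        filter_upwards [h0] with ω hω hR
        replace hR : brownianCoverageRadius Y W (flatBall m 1) ω < ENNReal.ofReal (1 / (2 * n)) :=
          hR
        simp only [brownianCoverageRadius, coverageRadius, iInf_lt_iff] at hR
        obtain ⟨r, hcov, hr⟩ := hR
        rw [← ENNReal.ofReal_coe_nnreal] at hr
        replace hr := (ENNReal.ofReal_lt_ofReal_iff_of_nonneg r.2).1 hr
        refine mem_iInter₂.2 fun k _ => ?_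
        obtain ⟨i, hi⟩ := exists_mem_cell_of_subset_cylinderSet hr (fun i => by simp [hω i]) hcov
          (e k)
        simp only [mem_preimage, mem_compl_iff, mem_singleton_iff]
        rw [pointMeasure_apply _ _ (measurableSet_cell n _), ENNReal.tsum_eq_zero]
        intro hz
        simpa [hi] using hz i
    _ = ∏ _k : Fin (Fintype.card (Fin m → Fin n)),
          ENNReal.ofReal (1 - Real.exp (-(ρ * (1 / n) ^ m))) := by
        rw [hind.measure_inter_preimage_eq_mul _ (fun _ _ => (measurableSet_singleton 0).compl)]
        refine Finset.prod_congr rfl fun k _ => ?_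
        have := h.poisson.measure_pointMeasure_ne_zero (measurableSet_cell n (e k))
          (by rw [hvol]; exact ENNReal.ofReal_lt_top)
        rw [hvol, ENNReal.toReal_ofReal (by positivity)] at this
        exact this
    _ = _ := by
        have : (0 : ℝ) ≤ 1 - Real.exp (-(ρ * (1 / n) ^ m)) := by
          have : 0 ≤ ρ * (1 / (n : ℝ)) ^ m := by positivity
          rw [sub_nonneg, Real.exp_le_one_iff]
          linarith
        rw [ENNReal.ofReal_pow this]
        simp

/-- A union bound over infinitely many particles: motions are independent of starting points, and
the probabilities of starting in the cube sum to the expected count `ρ`. -/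
theorem measure_exists_roughFunctions_le (h : IsBrownianModel ρ Y W P) {T : ℕ} (hT : T ≠ 0)
    {ε : ℝ} (hε : 0 < ε) :
    P {ω | ∃ i, Y i ω ∈ base m ∧ ∃ j, (fun t => W i t ω j) ∈ roughFunctions T ε} ≤
      ENNReal.ofReal ρ * (m * ENNReal.ofReal (40 / (T * ε ^ 4))) := by
  let R : Set (ℝ≥0 → EuclideanSpace ℝ (Fin m)) := ⋃ j, {w | (fun t => w t j) ∈ roughFunctions T ε}
  have hR : MeasurableSet R := by
    refine MeasurableSet.iUnion fun j => ?_
    refine MeasurableSet.preimage (measurableSet_roughFunctions T ε) ?_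
    fun_prop
  have hPR : ∀ i, P {ω | (fun t => W i t ω) ∈ R} ≤ m * ENNReal.ofReal (40 / (T * ε ^ 4)) := by
    intro i
    calc P {ω | (fun t => W i t ω) ∈ R}
        = P (⋃ j, {ω | (fun t => W i t ω j) ∈ roughFunctions T ε}) := by
          congr 1; ext ω; simp [R]
      _ ≤ ∑ j, P {ω | (fun t => W i t ω j) ∈ roughFunctions T ε} := measure_iUnion_fintype_le _ _
      _ ≤ ∑ _j : Fin m, ENNReal.ofReal (40 / (T * ε ^ 4)) := Finset.sum_le_sum fun j _ =>
          measure_roughFunctions_le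
            ((h.brownian i).isBrownianReal j).toIsPreBrownianReal hT hε
      _ = _ := by simp
  have hbase : (ENNReal.ofReal ρ • (volume : Measure (EuclideanSpace ℝ (Fin m)))) (base m) =
      ENNReal.ofReal ρ := by
    rw [Measure.smul_apply, volume_base, smul_eq_mul, mul_one]
  have hsum : ∑' i, P {ω | Y i ω ∈ base m} = ENNReal.ofReal ρ := by
    rw [← hbase, ← h.poisson.lintegral_pointMeasure_apply (measurableSet_base m)
      (by rw [hbase]; exact ENNReal.ofReal_lt_top)]
    simp only [pointMeasure_apply _ _ (measurableSet_base m)]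
    rw [lintegral_tsum (f := fun i ω => (base m).indicator 1 (Y i ω)) fun i =>
      ((measurable_one.indicator (measurableSet_base m)).comp
        (h.poisson.measurable i)).aemeasurable]
    refine tsum_congr fun i => ?_
    exact (lintegral_indicator_one (h.poisson.measurable i (measurableSet_base m))).symm
  have hind : ∀ i, P {ω | Y i ω ∈ base m ∧ (fun t => W i t ω) ∈ R} =
      P {ω | Y i ω ∈ base m} * P {ω | (fun t => W i t ω) ∈ R} := fun i =>
    (h.indep_starts.comp (measurable_pi_apply i)
      (measurable_pi_apply i)).measure_inter_preimage_eq_mul _ _ (measurableSet_base m) hR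
  calc P {ω | ∃ i, Y i ω ∈ base m ∧ ∃ j, (fun t => W i t ω j) ∈ roughFunctions T ε}
      ≤ P (⋃ i, {ω | Y i ω ∈ base m ∧ (fun t => W i t ω) ∈ R}) := by
        refine measure_mono fun ω ⟨i, hi, j, hj⟩ => mem_iUnion.2 ⟨i, hi, mem_iUnion.2 ⟨j, hj⟩⟩
    _ ≤ ∑' i, P {ω | Y i ω ∈ base m ∧ (fun t => W i t ω) ∈ R} := measure_iUnion_le _
    _ ≤ ∑' i, P {ω | Y i ω ∈ base m} * (m * ENNReal.ofReal (40 / (T * ε ^ 4))) := by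
        refine ENNReal.tsum_le_tsum fun i => ?_
        rw [hind]
        gcongr
        exact hPR i
    _ = _ := by rw [ENNReal.tsum_mul_right, hsum]

variable [IsProbabilityMeasure P]

theorem measure_forall_notMem_cell_le (h : IsBrownianModel ρ Y W P) {t : ℝ≥0} (ht : t ≤ 1) {n : ℕ}
    (hn : 2 ≤ n) (k : Fin m → Fin n) :
    P {ω | ∀ i, ¬ (Y i ω ∈ base m ∧ Y i ω + W i t ω ∈ cell n k)} ≤
      negExp (ENNReal.ofReal ρ * (gaussianQuarter ^ m * ENNReal.ofReal ((1 / n) ^ m)) / 2) := by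
  have hY : IndepFun (fun ω i => Y i ω) (fun ω i => W i t ω) P :=
    h.indep_starts.comp (φ := id)
      (ψ := fun (w : ℕ → ℝ≥0 → EuclideanSpace ℝ (Fin m)) i => w i t) measurable_id (by fun_prop)
  have hξ : iIndepFun (fun i => W i t) P :=
    h.indep_motions.comp (fun _ w => w t) fun _ => measurable_pi_apply t
  have hlin : ∫⁻ y, heatMeasure m t (Prod.mk y ⁻¹' hitSet n k) ∂(ENNReal.ofReal ρ • volume) =
      ENNReal.ofReal ρ * ∫⁻ y, heatMeasure m t (Prod.mk y ⁻¹' hitSet n k) := by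
    rw [lintegral_smul_measure, smul_eq_mul]
  refine (h.poisson.measure_forall_notMem_le hY hξ (fun i => (h.brownian i).hasLaw t)
    (fun i => (h.brownian i).measurable t) (measurableSet_hitSet n k) ?_).trans ?_
  · rw [hlin]
    exact ENNReal.mul_ne_top ENNReal.ofReal_ne_top (lintegral_heatMeasure_hitSet_ne_top t n k)
  · rw [hlin]
    refine negExp_antitone ?_
    gcongr
    exact le_lintegral_heatMeasure_hitSet ht hn k

theorem measure_lt_coverageRadius_le (h : IsBrownianModel ρ Y W P) {n T : ℕ} (hn : 2 ≤ n)
    (hT : T ≠ 0) {ε : ℝ} (hε : 0 < ε) :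
    P {ω | ENNReal.ofReal ((m + 1) * (1 / n + 10 * ε)) <
        brownianCoverageRadius Y W (flatBall m 1) ω} ≤
      ENNReal.ofReal ρ * (m * ENNReal.ofReal (40 / (T * ε ^ 4))) +
        (T + 1 : ℕ) * ((n ^ m : ℕ) * negExp
          (ENNReal.ofReal ρ * (gaussianQuarter ^ m * ENNReal.ofReal ((1 / n) ^ m)) / 2)) := by
  have hc : ∀ᵐ ω ∂P, ∀ i j, Continuous fun t => W i t ω j := by
    rw [ae_all_iff]
    intro i
    rw [ae_all_iff]
    exact fun j => ((h.brownian i).isBrownianReal j).cont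
  calc P {ω | ENNReal.ofReal ((m + 1) * (1 / n + 10 * ε)) <
        brownianCoverageRadius Y W (flatBall m 1) ω}
      ≤ P ({ω | ∃ i, Y i ω ∈ base m ∧ ∃ j, (fun t => W i t ω j) ∈ roughFunctions T ε} ∪
          ⋃ l ∈ Finset.range (T + 1), ⋃ k : Fin m → Fin n,
            {ω | ∀ i, ¬ (Y i ω ∈ base m ∧ Y i ω + W i (l / T) ω ∈ cell n k)}) := by
        refine measure_mono_ae ?_
        filter_upwards [hc] with ω hω hR
        by_contra hbad
        refine (not_le.2 (show ENNReal.ofReal ((m + 1) * (1 / n + 10 * ε)) <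
          brownianCoverageRadius Y W (flatBall m 1) ω from hR)) ?_
        have h1 := fun h1 => hbad (Or.inl h1)
        have h2 := fun h2 => hbad (Or.inr h2)
        refine coverageRadius_le (by omega) hT hε.le hω
          (fun i hi j hj => h1 ⟨i, hi, j, hj⟩) fun l hl k => ?_
        by_contra hk
        refine h2 (mem_iUnion₂.2 ⟨l, Finset.mem_range.2 (by omega), mem_iUnion.2 ⟨k, ?_⟩⟩)
        exact fun i hi => hk ⟨i, hi⟩
    _ ≤ _ := measure_union_le _ _
    _ ≤ _ := by
        refine add_le_add (h.measure_exists_roughFunctions_le hT hε) ?_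
        refine (measure_biUnion_finset_le _ _).trans ?_
        calc _ ≤ ∑ _l ∈ Finset.range (T + 1), ((n ^ m : ℕ) * negExp
              (ENNReal.ofReal ρ * (gaussianQuarter ^ m * ENNReal.ofReal ((1 / n) ^ m)) / 2)) := by
              refine Finset.sum_le_sum fun l hl => (measure_iUnion_fintype_le _ _).trans ?_
              calc _ ≤ ∑ _k : Fin m → Fin n, negExp (ENNReal.ofReal ρ *
                    (gaussianQuarter ^ m * ENNReal.ofReal ((1 / n) ^ m)) / 2) := by
                    refine Finset.sum_le_sum fun k _ => h.measure_forall_notMem_cell_le ?_ hn k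
                    refine div_le_one_of_le₀ ?_ zero_le
                    exact_mod_cast Finset.mem_range_succ_iff.1 hl
                _ = _ := by simp
          _ = _ := by simp

end IsBrownianModel

/-! ### Choice of the grids as functions of `ρ`. -/

theorem tendsto_div_log_atTop : Tendsto (fun ρ : ℝ => ρ / Real.log ρ) atTop atTop := by
  have h : Tendsto (fun ρ : ℝ => Real.log ρ / ρ) atTop (𝓝[>] 0) := by
    rw [tendsto_nhdsWithin_iff]
    refine ⟨Real.isLittleO_log_id_atTop.tendsto_div_nhds_zero, ?_⟩
    filter_upwards [eventually_gt_atTop 1] with ρ hρ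
    exact div_pos (Real.log_pos hρ) (by linarith)
  refine h.inv_tendsto_nhdsGT_zero.congr fun ρ => ?_
  rw [Pi.inv_apply, inv_div]

theorem eventually_two_le_rpow {m : ℕ} (hm : m ≠ 0) {a : ℝ} (ha : 0 < a) :
    ∀ᶠ ρ : ℝ in atTop, 2 ≤ (a * (ρ / Real.log ρ)) ^ (1 / (m : ℝ)) := by
  have h := (tendsto_rpow_atTop (y := 1 / (m : ℝ)) (by positivity)).comp
    (tendsto_div_log_atTop.const_mul_atTop ha)
  exact h.eventually_ge_atTop 2

theorem one_div_rpow_eq {m : ℕ} {a ρ : ℝ} (ha : 0 < a) (hρ : 1 < ρ) :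
    1 / (a * (ρ / Real.log ρ)) ^ (1 / (m : ℝ)) =
      (1 / a) ^ (1 / (m : ℝ)) * (Real.log ρ / ρ) ^ (1 / (m : ℝ)) := by
  have hl := Real.log_pos hρ
  rw [← Real.mul_rpow (by positivity) (by positivity), one_div, ← Real.inv_rpow (by positivity)]
  congr 1
  field_simp

/-- With `n ^ m ≥ 2 * ρ / log ρ` a cell has mean at most `log ρ / 2`, hence is empty with
probability at least `1 / √ρ`; the expected number of empty cells is then at least `2 * √ρ / log ρ`.
In the constant `1 / 8`, one factor `1 / 2` comes from `1 / (2 * n)`, one from `n ≤ 2 * x`, and one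
from `(1 / 2) ^ (1 / m) ≥ 1 / 2`. -/
theorem eventually_exists_coarse_grid {m : ℕ} (hm : m ≠ 0) :
    ∀ᶠ ρ : ℝ in atTop, ∃ n : ℕ,
      1 / 8 * (Real.log ρ / ρ) ^ (1 / (m : ℝ)) ≤ 1 / (2 * n) ∧
      (1 - Real.exp (-(ρ * (1 / n) ^ m))) ^ (n ^ m) ≤ Real.exp (-(2 * (√ρ / Real.log ρ))) := by
  filter_upwards [eventually_two_le_rpow hm two_pos, eventually_gt_atTop 1] with ρ hx hρ
  have hl := Real.log_pos hρ
  set x : ℝ := (2 * (ρ / Real.log ρ)) ^ (1 / (m : ℝ)) with hx_def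
  have hxm : x ^ m = 2 * (ρ / Real.log ρ) := by
    rw [hx_def, one_div, Real.rpow_inv_natCast_pow (by positivity) hm]
  have hn1 : x ≤ ⌈x⌉₊ := Nat.le_ceil x
  have hn2 : (⌈x⌉₊ : ℝ) ≤ 2 * x := by
    have := Nat.ceil_lt_add_one (show 0 ≤ x by linarith)
    linarith
  have hn0 : (0 : ℝ) < ⌈x⌉₊ := by linarith
  refine ⟨⌈x⌉₊, ?_, ?_⟩
  · have h1 : 1 / x ≤ 1 / (⌈x⌉₊ : ℝ) * 2 := by
      rw [div_mul_eq_mul_div, one_mul, div_le_div_iff₀ (by linarith) hn0]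
      linarith
    rw [hx_def, one_div_rpow_eq two_pos hρ] at h1
    have h2 : (1 / 2 : ℝ) ≤ (1 / 2) ^ (1 / (m : ℝ)) := by
      conv_lhs => rw [← Real.rpow_one (1 / 2)]
      refine Real.rpow_le_rpow_of_exponent_ge (by norm_num) (by norm_num) ?_
      rw [div_le_one (by positivity)]
      exact_mod_cast Nat.one_le_iff_ne_zero.2 hm
    have h3 : (0 : ℝ) ≤ (Real.log ρ / ρ) ^ (1 / (m : ℝ)) := by positivity
    have h4 : (1 : ℝ) / (2 * ⌈x⌉₊) = 1 / ⌈x⌉₊ / 2 := by field_simp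
    rw [h4]
    rw [← hx_def] at h1
    nlinarith
  · have hnm : 2 * (ρ / Real.log ρ) ≤ (⌈x⌉₊ : ℝ) ^ m := by
      rw [← hxm]
      gcongr
    have h1 : ρ * (1 / (⌈x⌉₊ : ℝ)) ^ m ≤ Real.log ρ / 2 := by
      rw [one_div_pow, mul_one_div, div_le_iff₀ (by positivity)]
      calc ρ = Real.log ρ / 2 * (2 * (ρ / Real.log ρ)) := by field_simp
        _ ≤ _ := by gcongr
    have h2 : 1 / √ρ ≤ Real.exp (-(ρ * (1 / (⌈x⌉₊ : ℝ)) ^ m)) := by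
      calc 1 / √ρ = Real.exp (-(Real.log ρ / 2)) := by
            rw [Real.exp_neg, ← Real.log_sqrt (by linarith), Real.exp_log (by positivity), one_div]
        _ ≤ _ := by gcongr
    calc (1 - Real.exp (-(ρ * (1 / (⌈x⌉₊ : ℝ)) ^ m))) ^ (⌈x⌉₊ ^ m)
        ≤ (Real.exp (-(1 / √ρ))) ^ (⌈x⌉₊ ^ m) := by
          refine pow_le_pow_left₀ ?_ ?_ _
          · rw [sub_nonneg, Real.exp_le_one_iff, neg_nonpos]
            positivity
          · have := Real.add_one_le_exp (-(1 / √ρ))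
            linarith
      _ = Real.exp (-((⌈x⌉₊ : ℝ) ^ m * (1 / √ρ))) := by
          rw [← Real.exp_nat_mul]
          push_cast
          ring_nf
      _ ≤ Real.exp (-(2 * (√ρ / Real.log ρ))) := by
          refine Real.exp_le_exp.2 (neg_le_neg ?_)
          calc 2 * (√ρ / Real.log ρ) = 2 * (ρ / Real.log ρ) * (1 / √ρ) := by
                rw [show (2 * (ρ / Real.log ρ) * (1 / √ρ)) = 2 * ((ρ / √ρ) / Real.log ρ) by
                  field_simp, Real.div_sqrt]
            _ ≤ _ := by gcongr

theorem tendsto_exp_neg_sqrt_div_log :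
    Tendsto (fun ρ : ℝ => Real.exp (-(2 * (√ρ / Real.log ρ)))) atTop (𝓝 0) := by
  refine Real.tendsto_exp_neg_atTop_nhds_zero.comp
    (Tendsto.const_mul_atTop two_pos ?_)
  have h : Tendsto (fun ρ : ℝ => √ρ / Real.log √ρ * (1 / 2)) atTop atTop :=
    (tendsto_div_log_atTop.comp Real.tendsto_sqrt_atTop).atTop_mul_const (by norm_num)
  refine h.congr' ?_
  filter_upwards [eventually_gt_atTop 1] with ρ hρ
  have hl := Real.log_pos hρ
  rw [Real.log_sqrt (by linarith)]
  field_simp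

theorem eventually_exists_fine_grid {m : ℕ} (hm : m ≠ 0) {g : ℝ} (hg : 0 < g) (hg1 : g ≤ 1) :
    ∀ᶠ ρ : ℝ in atTop, ∃ n T : ℕ, ∃ ε : ℝ, 2 ≤ n ∧ T ≠ 0 ∧ 0 < ε ∧
      ((m : ℝ) + 1) * (1 / n + 10 * ε) ≤
        22 * (m + 1) * (24 / g) ^ (1 / (m : ℝ)) * (Real.log ρ / ρ) ^ (1 / (m : ℝ)) ∧
      ρ * (m * (40 / (T * ε ^ 4))) +
        (T + 1 : ℕ) * ((n ^ m : ℕ) * Real.exp (-(ρ * (g * (1 / n) ^ m) / 2))) ≤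
        (40 * m + 257) / ρ := by
  -- With `n ^ m ≤ (g / 24) * ρ / log ρ` the void exponent `ρ * g / (2 * n ^ m)` is at least `12 *
  -- log ρ`.
  have ha : 0 < g / 24 := by positivity
  filter_upwards [eventually_two_le_rpow hm ha, eventually_ge_atTop (Real.exp 1)] with ρ hx hρe
  have hl1 : 1 ≤ Real.log ρ := by
    rw [Real.le_log_iff_exp_le ((Real.exp_pos 1).trans_le hρe)]
    exact hρe
  have hρ : 1 < ρ := by
    have := Real.add_one_lt_exp (one_ne_zero)
    linarith
  set x : ℝ := (g / 24 * (ρ / Real.log ρ)) ^ (1 / (m : ℝ)) with hx_def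
  have hxm : x ^ m = g / 24 * (ρ / Real.log ρ) := by
    rw [hx_def, one_div, Real.rpow_inv_natCast_pow (by positivity) hm]
  have hn2 : 2 ≤ ⌊x⌋₊ := Nat.le_floor (by exact_mod_cast hx)
  have hnx : (⌊x⌋₊ : ℝ) ≤ x := Nat.floor_le (by linarith)
  have hxn : x < ⌊x⌋₊ + 1 := Nat.lt_floor_add_one x
  have hn2' : (2 : ℝ) ≤ ⌊x⌋₊ := by exact_mod_cast hn2
  have hn0 : (0 : ℝ) < ⌊x⌋₊ := by linarith
  set n := ⌊x⌋₊
  have hnm : (n : ℝ) ^ m ≤ g / 24 * (ρ / Real.log ρ) := by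
    rw [← hxm]
    gcongr
  have hnmρ : (n : ℝ) ^ m ≤ ρ := by
    refine hnm.trans ?_
    have : ρ / Real.log ρ ≤ ρ := div_le_self (by linarith) hl1
    have h0 : 0 ≤ ρ / Real.log ρ := by positivity
    nlinarith
  have hnρ : (n : ℝ) ≤ ρ := (le_self_pow₀ (by linarith) hm).trans hnmρ
  have hτ1 : ρ ≤ ⌈ρ⌉₊ := Nat.le_ceil ρ
  have hτ2 : (⌈ρ⌉₊ : ℝ) ≤ 2 * ρ := by
    have := Nat.ceil_lt_add_one (show 0 ≤ ρ by linarith)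
    linarith
  set τ := ⌈ρ⌉₊
  have hτ0 : (0 : ℝ) < τ := by linarith
  have hτ0' : τ ≠ 0 := by
    rintro h
    rw [h] at hτ0
    simp at hτ0
  -- `ε = 1 / τ` is at most `1 / n`, so oscillation does not change the order of the radius. `T = τ
  -- ^ 8` makes the roughness term of order `ρ / τ ^ 4`, while the `O(ρ ^ 8)` times and at most `ρ`
  -- cells are beaten by the void bound `ρ ^ (-12)`.
  refine ⟨n, τ ^ 8, 1 / τ, hn2, pow_ne_zero _ hτ0', by positivity, ?_, ?_⟩
  · have h1 : (1 : ℝ) / τ ≤ 1 / n := by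
      gcongr
      exact_mod_cast hnρ.trans hτ1
    have h2 : (1 : ℝ) / n ≤ 2 * (1 / x) := by
      rw [mul_one_div, div_le_div_iff₀ hn0 (by linarith)]
      linarith
    rw [hx_def, one_div_rpow_eq ha hρ, one_div_div] at h2
    calc ((m : ℝ) + 1) * (1 / n + 10 * (1 / τ))
        ≤ (m + 1) * (11 * (2 * ((24 / g) ^ (1 / (m : ℝ)) *
          (Real.log ρ / ρ) ^ (1 / (m : ℝ))))) := by
          gcongr
          linarith
      _ = _ := by ring
  · have h1 : ρ * (m * (40 / ((τ ^ 8 : ℕ) * (1 / (τ : ℝ)) ^ 4))) ≤ 40 * m / ρ := by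
      have e1 : ρ * (m * (40 / ((τ ^ 8 : ℕ) * (1 / (τ : ℝ)) ^ 4))) = 40 * m * (ρ / τ ^ 4) := by
        push_cast
        field_simp
      have e2 : ρ / (τ : ℝ) ^ 4 ≤ 1 / ρ := by
        rw [div_le_div_iff₀ (by positivity) (by positivity)]
        calc ρ * ρ = ρ ^ 2 := by ring
          _ ≤ ρ ^ 4 := pow_le_pow_right₀ hρ.le (by norm_num)
          _ ≤ 1 * (τ : ℝ) ^ 4 := by
            rw [one_mul]
            gcongr
      rw [e1, show 40 * (m : ℝ) / ρ = 40 * m * (1 / ρ) by ring]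
      gcongr
    have h2 : Real.exp (-(ρ * (g * (1 / (n : ℝ)) ^ m) / 2)) ≤ 1 / ρ ^ 12 := by
      have e1 : 12 * Real.log ρ ≤ ρ * (g * (1 / (n : ℝ)) ^ m) / 2 := by
        rw [one_div_pow, le_div_iff₀ two_pos, mul_one_div, mul_div_assoc', le_div_iff₀ (by positivity)]
        calc 12 * Real.log ρ * 2 * (n : ℝ) ^ m
            ≤ 12 * Real.log ρ * 2 * (g / 24 * (ρ / Real.log ρ)) := by gcongr
          _ = ρ * g := by field_simp; ring
      calc Real.exp (-(ρ * (g * (1 / (n : ℝ)) ^ m) / 2)) ≤ Real.exp (-(12 * Real.log ρ)) := by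
            gcongr
        _ = 1 / ρ ^ 12 := by
            rw [Real.exp_neg, one_div, show (12 : ℝ) * Real.log ρ = (12 : ℕ) * Real.log ρ by
              norm_num, Real.exp_nat_mul, Real.exp_log (by linarith)]
    -- `257 = 2 ^ 8 + 1`, from `τ ≤ 2 * ρ` and `1 ≤ ρ ^ 8`.
    have h3 : ((τ ^ 8 + 1 : ℕ) : ℝ) ≤ 257 * ρ ^ 8 := by
      push_cast
      have e1 : (τ : ℝ) ^ 8 ≤ (2 * ρ) ^ 8 := by gcongr
      have e2 : (1 : ℝ) ≤ ρ ^ 8 := one_le_pow₀ hρ.le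
      rw [mul_pow] at e1
      norm_num at e1
      linarith
    have h4 : ((τ ^ 8 + 1 : ℕ) : ℝ) * ((n ^ m : ℕ) *
        Real.exp (-(ρ * (g * (1 / (n : ℝ)) ^ m) / 2))) ≤ 257 / ρ := by
      calc ((τ ^ 8 + 1 : ℕ) : ℝ) * ((n ^ m : ℕ) *
            Real.exp (-(ρ * (g * (1 / (n : ℝ)) ^ m) / 2)))
          ≤ 257 * ρ ^ 8 * (ρ * (1 / ρ ^ 12)) := by
            push_cast at h3 ⊢
            gcongr
        _ = 257 * (1 / ρ ^ 3) := by field_simp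
        _ ≤ 257 * (1 / ρ ^ 1) := by
            gcongr
            · exact hρ.le
            · norm_num
        _ = 257 / ρ := by ring
    rw [add_div]
    exact add_le_add h1 h4

/-! ### Limits as `ρ → ∞` and conclusion. -/

namespace IsBrownianModel

variable {Ω : Type*} [MeasurableSpace Ω] {P : Measure Ω} {m : ℕ}
  {Y : ℝ → ℕ → Ω → EuclideanSpace ℝ (Fin m)} {W : ℝ → ℕ → ℝ≥0 → Ω → EuclideanSpace ℝ (Fin m)}

theorem tendsto_measure_coverageRadius_lt (hm : m ≠ 0)
    (h : ∀ ρ : ℝ, 0 < ρ → IsBrownianModel ρ (Y ρ) (W ρ) P) :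
    Tendsto (fun ρ : ℝ => P {ω | brownianCoverageRadius (Y ρ) (W ρ) (flatBall m 1) ω <
      ENNReal.ofReal (1 / 8 * (Real.log ρ / ρ) ^ (1 / (m : ℝ)))}) atTop (𝓝 0) := by
  have hlim := ENNReal.tendsto_ofReal tendsto_exp_neg_sqrt_div_log
  rw [ENNReal.ofReal_zero] at hlim
  refine tendsto_of_tendsto_of_tendsto_of_le_of_le' tendsto_const_nhds hlim
    (Eventually.of_forall fun _ => zero_le) ?_
  filter_upwards [eventually_exists_coarse_grid hm, eventually_gt_atTop 0] with ρ ⟨n, hn, hle⟩ hρ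
  refine (measure_mono fun ω hω => ?_).trans
    (((h ρ hρ).measure_coverageRadius_lt_le hρ.le n).trans (ENNReal.ofReal_le_ofReal hle))
  exact lt_of_lt_of_le hω (ENNReal.ofReal_le_ofReal hn)

theorem exists_tendsto_measure_lt_coverageRadius (hm : m ≠ 0) :
    ∃ c : ℝ, 0 < c ∧ ∀ (Ω : Type*) [MeasurableSpace Ω] (P : Measure Ω) [IsProbabilityMeasure P]
      (Y : ℝ → ℕ → Ω → EuclideanSpace ℝ (Fin m))
      (W : ℝ → ℕ → ℝ≥0 → Ω → EuclideanSpace ℝ (Fin m)),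
      (∀ ρ : ℝ, 0 < ρ → IsBrownianModel ρ (Y ρ) (W ρ) P) →
      Tendsto (fun ρ : ℝ => P {ω | ENNReal.ofReal (c * (Real.log ρ / ρ) ^ (1 / (m : ℝ))) <
        brownianCoverageRadius (Y ρ) (W ρ) (flatBall m 1) ω}) atTop (𝓝 0) := by
  have hg1 : gaussianQuarter ^ m ≤ 1 := pow_le_one₀ zero_le gaussianQuarter_le_one
  have hgt : gaussianQuarter ^ m ≠ ∞ := (hg1.trans_lt ENNReal.one_lt_top).ne
  set g := (gaussianQuarter ^ m).toReal with hg_def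
  have hg : 0 < g := ENNReal.toReal_pos (pow_ne_zero _ gaussianQuarter_pos.ne') hgt
  have hg1' : g ≤ 1 := ENNReal.toReal_le_of_le_ofReal zero_le_one (by simpa using hg1)
  have hgg : gaussianQuarter ^ m = ENNReal.ofReal g := (ENNReal.ofReal_toReal hgt).symm
  refine ⟨22 * (m + 1) * (24 / g) ^ (1 / (m : ℝ)), by positivity, fun Ω _ P _ Y W h => ?_⟩
  have hlim := ENNReal.tendsto_ofReal
    (tendsto_const_nhds.div_atTop (a := (40 * m + 257 : ℝ)) (tendsto_id (α := ℝ)))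
  rw [ENNReal.ofReal_zero] at hlim
  refine tendsto_of_tendsto_of_tendsto_of_le_of_le' tendsto_const_nhds hlim
    (Eventually.of_forall fun _ => zero_le) ?_
  filter_upwards [eventually_exists_fine_grid hm hg hg1', eventually_gt_atTop 0] with ρ
    ⟨n, T, ε, hn, hT, hε, hr, hle⟩ hρ
  refine (measure_mono fun ω hω => ?_).trans
    (((h ρ hρ).measure_lt_coverageRadius_le hn hT hε).trans
      (le_trans (le_of_eq ?_) (ENNReal.ofReal_le_ofReal hle)))
  · exact lt_of_le_of_lt (ENNReal.ofReal_le_ofReal hr) hω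
  · have e1 : ENNReal.ofReal ρ * (gaussianQuarter ^ m * ENNReal.ofReal ((1 / n) ^ m)) / 2 =
        ENNReal.ofReal (ρ * (g * (1 / n) ^ m) / 2) := by
      rw [hgg, ENNReal.ofReal_div_of_pos two_pos, ENNReal.ofReal_mul hρ.le,
        ENNReal.ofReal_mul hg.le]
      simp
    rw [e1, negExp_ofReal (by positivity), ENNReal.ofReal_add (by positivity) (by positivity),
      ENNReal.ofReal_mul hρ.le, ENNReal.ofReal_mul (by positivity),
      ENNReal.ofReal_mul (by positivity), ENNReal.ofReal_mul (by positivity)]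
    simp only [ENNReal.ofReal_natCast]

end IsBrownianModel

end BrownianCylinders

theorem theorem3 (d : ℕ) (hd : 2 ≤ d) :
    ∃ c₁ c₂ : ℝ, 0 < c₁ ∧ c₁ ≤ c₂ ∧
      ∀ (Ω : Type*) [MeasurableSpace Ω] (P : Measure Ω) [IsProbabilityMeasure P]
        (Y : ℝ → ℕ → Ω → EuclideanSpace ℝ (Fin (d - 1)))
        (W : ℝ → ℕ → ℝ≥0 → Ω → EuclideanSpace ℝ (Fin (d - 1))),
        (∀ ρ : ℝ, 0 < ρ → BrownianCylinders.IsBrownianModel ρ (Y ρ) (W ρ) P) →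
        Tendsto
          (fun ρ : ℝ => P {ω |
            ENNReal.ofReal c₁ ≤
              BrownianCylinders.brownianCoverageRadius (Y ρ) (W ρ)
                  (BrownianCylinders.flatBall (d - 1) 1) ω /
                ENNReal.ofReal ((Real.log ρ / ρ) ^ (1 / ((d : ℝ) - 1))) ∧
            BrownianCylinders.brownianCoverageRadius (Y ρ) (W ρ)
                  (BrownianCylinders.flatBall (d - 1) 1) ω /
                ENNReal.ofReal ((Real.log ρ / ρ) ^ (1 / ((d : ℝ) - 1))) ≤
              ENNReal.ofReal c₂})
          atTop (𝓝 1) := by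
  have hm : d - 1 ≠ 0 := by omega
  obtain ⟨c, hc, hupper⟩ :=
    BrownianCylinders.IsBrownianModel.exists_tendsto_measure_lt_coverageRadius hm
  -- The maximum serves only to guarantee `c₁ ≤ c₂`.
  refine ⟨1 / 8, max (1 / 8) c, by norm_num, le_max_left _ _, fun Ω _ P _ Y W h => ?_⟩
  have hcast : ((d - 1 : ℕ) : ℝ) = (d : ℝ) - 1 := by
    rw [Nat.cast_sub (by omega), Nat.cast_one]
  have hlow := BrownianCylinders.IsBrownianModel.tendsto_measure_coverageRadius_lt hm h
  have hup := hupper Ω P Y W h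
  have hlim := ENNReal.Tendsto.sub (tendsto_const_nhds (x := (1 : ℝ≥0∞))) (hlow.add hup)
    (Or.inl ENNReal.one_ne_top)
  rw [add_zero, tsub_zero] at hlim
  refine tendsto_of_tendsto_of_tendsto_of_le_of_le' hlim tendsto_const_nhds ?_
    (Eventually.of_forall fun _ => prob_le_one)
  filter_upwards [eventually_gt_atTop 1] with ρ hρ
  have hs : 0 < (Real.log ρ / ρ) ^ (1 / ((d : ℝ) - 1)) :=
    Real.rpow_pos_of_pos (div_pos (Real.log_pos hρ) (by linarith)) _
  have hs0 : ENNReal.ofReal ((Real.log ρ / ρ) ^ (1 / ((d : ℝ) - 1))) ≠ 0 := by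
    simpa using hs
  -- The whole space is covered by the good event and the two bad ones, so subadditivity suffices
  -- and no measurability of the coverage radius is needed.
  rw [tsub_le_iff_right, ← measure_univ (μ := P)]
  refine (measure_mono ?_).trans ((measure_union_le _ _).trans
    (add_le_add_right (measure_union_le _ _) _))
  intro ω _
  by_cases hω₁ : BrownianCylinders.brownianCoverageRadius (Y ρ) (W ρ)
      (BrownianCylinders.flatBall (d - 1) 1) ω <
      ENNReal.ofReal (1 / 8 * (Real.log ρ / ρ) ^ (1 / ((d - 1 : ℕ) : ℝ)))
  · exact Or.inr (Or.inl hω₁)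
  by_cases hω₂ : ENNReal.ofReal (c * (Real.log ρ / ρ) ^ (1 / ((d - 1 : ℕ) : ℝ))) <
      BrownianCylinders.brownianCoverageRadius (Y ρ) (W ρ)
        (BrownianCylinders.flatBall (d - 1) 1) ω
  · exact Or.inr (Or.inr hω₂)
  rw [not_lt, hcast] at hω₁ hω₂
  refine Or.inl ⟨?_, ?_⟩
  · rw [ENNReal.le_div_iff_mul_le (Or.inl hs0) (Or.inl ENNReal.ofReal_ne_top),
      ← ENNReal.ofReal_mul (by norm_num)]
    exact hω₁
  · refine ENNReal.div_le_of_le_mul (hω₂.trans ?_)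
    rw [ENNReal.ofReal_mul hc.le]
    gcongr
    exact le_max_right _ _
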